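/- Let $\mathbb D=\{z\in\mathbb C:|z|<1\}$, let $p>1$ and $\alpha>-1$, and let $dA_\alpha(z)=(1+\alpha)(1-|z|^2)^\alpha\,\frac{dx\,dy}{\pi}$ on $\mathbb D$. Let $\mathcal D^p_\alpha$ be the space of all holomorphic functions $f$ on $\mathbb D$ such that $$\|f\|_{\mathcal D^p_\alpha}=\Big(|f(0)|^p+\int_{\mathbb D}|f'(z)|^p\,dA_\alpha(z)\Big)^{1/p}<\infty .$$ Let $\varphi\in\mathcal D^p_\alpha$ satisfy $\varphi(\mathbb D)\subset\mathbb D$, and let $C_\varphi f=f\circ\varphi$. For $\lambda\in\mathbb D$ and $\beta\ge 0$ put $F_{\lambda,\beta}(z)=(1-\overline\lambda z)^{-(1+\beta)}$, $z\in\mathbb D$ (principal branch). Fix $\beta\ge 0$ such that $\delta:=2+\beta-\frac{2+\alpha}{p}>0$. Then: (a) $C_\varphi$ maps $\mathcal D^p_\alpha$ into itself and is bounded there if and only if $\displaystyle\sup_{\lambda\in\mathbb D}(1-|\lambda|^2)^\delta\,\|F_{\lambda,\beta}\circ\varphi\|_{\mathcal D^p_\alpha}<\infty$. (b) $C_\varphi$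 maps $\mathcal D^p_\alpha$ into itself and is compact there if and only if $\displaystyle\lim_{|\lambda|\to1}(1-|\lambda|^2)^\delta\,\|F_{\lambda,\beta}\circ\varphi\|_{\mathcal D^p_\alpha}=0$. -/

import Mathlib

open MeasureTheory Filter Topology
open scoped ENNReal ComplexConjugate Complex.UnitDisc

noncomputable section

namespace WeightedDirichlet

/-- The function on `ℂ` that agrees with `f` on the open unit disc and vanishes elsewhere. It only
serves to speak of holomorphy and of the derivative of `f` at points of the (open) disc. -/
def extendZero (f : 𝔻 → ℂ) (z : ℂ) : ℂ :=
  if h : ‖z‖ < 1 then f (Complex.UnitDisc.mk z h) else 0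

/-- `f` is holomorphic on the open unit disc. -/
def IsHolo (f : 𝔻 → ℂ) : Prop :=
  DifferentiableOn ℂ (extendZero f) (Metric.ball 0 1)

/-- The complex derivative of `f`, meaningful at points of the open unit disc. -/
def derivDisc (f : 𝔻 → ℂ) : ℂ → ℂ := deriv (extendZero f)

/-- The measure `dA_α = (1 + α) (1 - |z|²)^α dx dy / π` on the open unit disc
(as a measure on `ℂ` carried by the disc). -/
def weightedArea (α : ℝ) : Measure ℂ :=
  ((volume : Measure ℂ).restrict (Metric.ball 0 1)).withDensity
    (fun z => ENNReal.ofReal ((1 + α) * (1 - ‖z‖ ^ 2) ^ α / Real.pi))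

/-- The `[0, ∞]`-valued norm `(|f(0)|^p + ∫ |f'|^p dA_α)^(1/p)` of `𝓓^p_α`. -/
def dirichletENorm (p α : ℝ) (f : 𝔻 → ℂ) : ℝ≥0∞ :=
  (‖f 0‖ₑ ^ p + ∫⁻ z, ‖derivDisc f z‖ₑ ^ p ∂(weightedArea α)) ^ (1 / p)

/-- `f ∈ 𝓓^p_α`: `f` is holomorphic on the disc and its `𝓓^p_α` norm is finite. -/
def MemDirichlet (p α : ℝ) (f : 𝔻 → ℂ) : Prop :=
  IsHolo f ∧ dirichletENorm p α f < ∞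

/-- The test function `F_{λ,β}(z) = 1 / (1 - conj λ * z)^(1 + β)` (principal branch; the base has
positive real part). -/
def testFun (l : 𝔻) (β : ℝ) (z : 𝔻) : ℂ :=
  1 / (1 - conj (l : ℂ) * (z : ℂ)) ^ ((1 + β : ℝ) : ℂ)

/-! ### The normed space -/

lemma extendZero_coe (f : 𝔻 → ℂ) (z : 𝔻) : extendZero f z = f z := by
  simp [extendZero, z.norm_lt_one]

lemma extendZero_add (f g : 𝔻 → ℂ) : extendZero (f + g) = extendZero f + extendZero g := by
  funext z
  by_cases h : ‖z‖ < 1 <;> simp [extendZero, h]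

lemma extendZero_smul (c : ℂ) (f : 𝔻 → ℂ) : extendZero (c • f) = c • extendZero f := by
  funext z
  by_cases h : ‖z‖ < 1 <;> simp [extendZero, h]

lemma extendZero_zero : extendZero 0 = 0 := by
  funext z
  by_cases h : ‖z‖ < 1 <;> simp [extendZero, h]

lemma IsHolo.differentiableAt {f : 𝔻 → ℂ} (hf : IsHolo f) {z : ℂ}
    (hz : z ∈ Metric.ball (0 : ℂ) 1) : DifferentiableAt ℂ (extendZero f) z :=
  DifferentiableOn.differentiableAt hf (Metric.isOpen_ball.mem_nhds hz)

lemma weightedArea_ae_mem (α : ℝ) : ∀ᵐ z ∂(weightedArea α), z ∈ Metric.ball (0 : ℂ) 1 :=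
  (withDensity_absolutelyContinuous _ _).ae_le (ae_restrict_mem Metric.isOpen_ball.measurableSet)

lemma measurable_derivDisc (f : 𝔻 → ℂ) : Measurable (derivDisc f) := measurable_deriv _

lemma dirichletENorm_add_le {p : ℝ} (hp : 1 ≤ p) (α : ℝ) {f g : 𝔻 → ℂ} (hf : IsHolo f)
    (hg : IsHolo g) :
    dirichletENorm p α (f + g) ≤ dirichletENorm p α f + dirichletENorm p α g := by
  have hp0 : 0 < p := by linarith
  set μ := weightedArea α
  have key : ∀ h : 𝔻 → ℂ, dirichletENorm p α h =
      (∑ i : Fin 2, (![‖h 0‖ₑ, (∫⁻ z, ‖derivDisc h z‖ₑ ^ p ∂μ) ^ (1 / p)] i) ^ p) ^ (1 / p) := by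
    intro h
    simp only [Fin.sum_univ_two, Matrix.cons_val_zero, Matrix.cons_val_one]
    rw [← ENNReal.rpow_mul, one_div_mul_cancel hp0.ne', ENNReal.rpow_one]
    rfl
  have hint : (∫⁻ z, ‖derivDisc (f + g) z‖ₑ ^ p ∂μ) ^ (1 / p) ≤
      (∫⁻ z, ‖derivDisc f z‖ₑ ^ p ∂μ) ^ (1 / p) + (∫⁻ z, ‖derivDisc g z‖ₑ ^ p ∂μ) ^ (1 / p) := by
    refine le_trans ?_ (ENNReal.lintegral_Lp_add_le (μ := μ)
      (measurable_derivDisc f).enorm.aemeasurable (measurable_derivDisc g).enorm.aemeasurable hp)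
    refine ENNReal.rpow_le_rpow (lintegral_mono_ae ?_) (by positivity)
    filter_upwards [weightedArea_ae_mem α] with z hz
    refine ENNReal.rpow_le_rpow ?_ hp0.le
    simp only [derivDisc, extendZero_add]
    rw [deriv_add (hf.differentiableAt hz) (hg.differentiableAt hz)]
    exact enorm_add_le _ _
  rw [key f, key g, key (f + g)]
  refine le_trans ?_ (ENNReal.Lp_add_le _ _ _ hp)
  refine ENNReal.rpow_le_rpow (Finset.sum_le_sum fun i _ => ?_) (by positivity)
  refine ENNReal.rpow_le_rpow ?_ hp0.le
  fin_cases i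
  · simpa using enorm_add_le (f 0) (g 0)
  · simpa using hint

lemma dirichletENorm_smul {p : ℝ} (hp : 1 ≤ p) (α : ℝ) (c : ℂ) {f : 𝔻 → ℂ} (hf : IsHolo f) :
    dirichletENorm p α (c • f) = ‖c‖ₑ * dirichletENorm p α f := by
  have hp0 : 0 < p := by linarith
  have h1 : ∫⁻ z, ‖derivDisc (c • f) z‖ₑ ^ p ∂(weightedArea α) =
      ‖c‖ₑ ^ p * ∫⁻ z, ‖derivDisc f z‖ₑ ^ p ∂(weightedArea α) := by
    rw [← lintegral_const_mul _ ((measurable_derivDisc f).enorm.pow_const p)]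
    refine lintegral_congr_ae ?_
    filter_upwards [weightedArea_ae_mem α] with z hz
    simp only [derivDisc, extendZero_smul]
    rw [deriv_const_smul c (hf.differentiableAt hz), enorm_smul, ENNReal.mul_rpow_of_nonneg _ _ hp0.le]
  unfold dirichletENorm
  rw [h1, Pi.smul_apply, enorm_smul, ENNReal.mul_rpow_of_nonneg _ _ hp0.le, ← mul_add,
    ENNReal.mul_rpow_of_nonneg _ _ (by positivity), ← ENNReal.rpow_mul, mul_one_div_cancel hp0.ne',
    ENNReal.rpow_one]

lemma dirichletENorm_zero {p : ℝ} (hp : 1 ≤ p) (α : ℝ) : dirichletENorm p α 0 = 0 := by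
  have hp0 : 0 < p := by linarith
  have h : derivDisc 0 = 0 := by
    unfold derivDisc
    rw [extendZero_zero]
    exact deriv_zero
  simp [dirichletENorm, h, hp0]

lemma eq_zero_of_dirichletENorm_eq_zero {p α : ℝ} (hp : 1 ≤ p) (hα : -1 < α) {f : 𝔻 → ℂ}
    (hf : IsHolo f) (h : dirichletENorm p α f = 0) : f = 0 := by
  have hp0 : 0 < p := by linarith
  have hU : IsOpen (Metric.ball (0 : ℂ) 1) := Metric.isOpen_ball
  unfold dirichletENorm at h
  rw [ENNReal.rpow_eq_zero_iff_of_pos (by positivity), add_eq_zero,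
    ENNReal.rpow_eq_zero_iff_of_pos hp0, enorm_eq_zero,
    lintegral_eq_zero_iff ((measurable_derivDisc f).enorm.pow_const p)] at h
  obtain ⟨h0, h1⟩ := h
  have h2 : derivDisc f =ᵐ[(volume : Measure ℂ).restrict (Metric.ball 0 1)] 0 := by
    have h3 := (ae_withDensity_iff (by fun_prop)).1 h1
    filter_upwards [h3, ae_restrict_mem hU.measurableSet] with z hz hzb
    have hz1 : ‖z‖ < 1 := by simpa using hzb
    have : 0 < (1 + α) * (1 - ‖z‖ ^ 2) ^ α / Real.pi := by
      have : 0 < 1 - ‖z‖ ^ 2 := by nlinarith [norm_nonneg z]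
      have : 0 < 1 + α := by linarith
      positivity
    have h4 := hz (by simpa using this)
    simpa [ENNReal.rpow_eq_zero_iff_of_pos hp0] using h4
  have hcont : ContinuousOn (derivDisc f) (Metric.ball 0 1) :=
    (DifferentiableOn.deriv hf hU).continuousOn
  have h3 : Set.EqOn (derivDisc f) 0 (Metric.ball 0 1) :=
    Measure.eqOn_open_of_ae_eq h2 hU hcont continuousOn_const
  funext z
  have h4 := hU.is_const_of_deriv_eq_zero (convex_ball (0 : ℂ) 1).isPreconnected hf h3
    (x := (z : ℂ)) (y := ((0 : 𝔻) : ℂ)) (by simpa using z.norm_lt_one) (by simp)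
  rw [extendZero_coe, extendZero_coe, h0] at h4
  simpa using h4

variable (p α : ℝ) [hp : Fact (1 ≤ p)]

/-- The space `𝓓^p_α` as a linear space of functions on the disc. -/
def dirichletSubmodule : Submodule ℂ (𝔻 → ℂ) where
  carrier := {f | MemDirichlet p α f}
  add_mem' {f g} hf hg := by
    refine ⟨?_, (dirichletENorm_add_le hp.out α hf.1 hg.1).trans_lt (ENNReal.add_lt_top.2 ⟨hf.2, hg.2⟩)⟩
    unfold IsHolo
    rw [extendZero_add]
    exact DifferentiableOn.add hf.1 hg.1
  zero_mem' := by
    refine ⟨?_, by rw [dirichletENorm_zero hp.out]; exact ENNReal.zero_lt_top⟩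
    unfold IsHolo
    rw [extendZero_zero]
    exact differentiableOn_const 0
  smul_mem' c f hf := by
    refine ⟨?_, by rw [dirichletENorm_smul hp.out α c hf.1]; exact ENNReal.mul_lt_top (by simp) hf.2⟩
    unfold IsHolo
    rw [extendZero_smul]
    exact DifferentiableOn.const_smul hf.1 c

/-- The space `𝓓^p_α`. This is not an abbreviation, so that it does not inherit the topology of
pointwise convergence; its topology is the one of the norm below. -/
def DirichletSpace : Type := dirichletSubmodule p α

instance : AddCommGroup (DirichletSpace p α) :=
  inferInstanceAs (AddCommGroup (dirichletSubmodule p α))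

instance : Module ℂ (DirichletSpace p α) :=
  inferInstanceAs (Module ℂ (dirichletSubmodule p α))

instance : CoeFun (DirichletSpace p α) (fun _ => 𝔻 → ℂ) := ⟨fun f => f.1⟩

/-- The norm `‖f‖ = (|f(0)|^p + ∫ |f'|^p dA_α)^(1/p)`, finite on `𝓓^p_α`. -/
instance : Norm (DirichletSpace p α) := ⟨fun f => (dirichletENorm p α f.1).toReal⟩

lemma normedSpaceCore [hα : Fact (-1 < α)] : NormedSpace.Core ℂ (DirichletSpace p α) where
  norm_nonneg _ := ENNReal.toReal_nonneg
  norm_smul c f := by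
    change (dirichletENorm p α (c • f.1)).toReal = ‖c‖ * (dirichletENorm p α f.1).toReal
    rw [dirichletENorm_smul hp.out α c f.2.1]
    simp
  norm_triangle f g := by
    change (dirichletENorm p α (f.1 + g.1)).toReal ≤
      (dirichletENorm p α f.1).toReal + (dirichletENorm p α g.1).toReal
    rw [← ENNReal.toReal_add f.2.2.ne g.2.2.ne]
    exact ENNReal.toReal_mono (ENNReal.add_lt_top.2 ⟨f.2.2, g.2.2⟩).ne
      (dirichletENorm_add_le hp.out α f.2.1 g.2.1)
  norm_eq_zero_iff f := by
    change (dirichletENorm p α f.1).toReal = 0 ↔ f = 0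
    constructor
    · intro h
      rw [ENNReal.toReal_eq_zero_iff, or_iff_left f.2.2.ne] at h
      exact Subtype.ext (eq_zero_of_dirichletENorm_eq_zero hp.out hα.out f.2.1 h)
    · rintro rfl
      change (dirichletENorm p α 0).toReal = 0
      rw [dirichletENorm_zero hp.out]
      simp

instance [Fact (-1 < α)] : NormedAddCommGroup (DirichletSpace p α) :=
  NormedAddCommGroup.ofCore (normedSpaceCore p α)

instance [Fact (-1 < α)] : NormedSpace ℂ (DirichletSpace p α) :=
  NormedSpace.ofCore (normedSpaceCore p α)

/-- `C_φ` maps `𝓓^p_α` into itself and is a bounded operator there: some continuous linear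
operator `T` of `𝓓^p_α` is given by `T f = f ∘ φ`. -/
def CompositionBounded [Fact (-1 < α)] (φ : 𝔻 → 𝔻) : Prop :=
  ∃ T : DirichletSpace p α →L[ℂ] DirichletSpace p α, ∀ f, (T f : 𝔻 → ℂ) = (f : 𝔻 → ℂ) ∘ φ

/-- `C_φ` maps `𝓓^p_α` into itself and is a compact operator there. -/
def CompositionCompact [Fact (-1 < α)] (φ : 𝔻 → 𝔻) : Prop :=
  ∃ T : DirichletSpace p α →L[ℂ] DirichletSpace p α,
    (∀ f, (T f : 𝔻 → ℂ) = (f : 𝔻 → ℂ) ∘ φ) ∧ IsCompactOperator T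

/-- The quantity `(1 - |λ|²)^δ ‖F_{λ,β} ∘ φ‖` with `δ = 2 + β - (2 + α) / p`, where the norm is
that of `𝓓^p_α`, with values in `[0, ∞]`. -/
def testQuantity (p α β : ℝ) (φ : 𝔻 → 𝔻) (l : 𝔻) : ℝ≥0∞ :=
  ENNReal.ofReal ((1 - ‖(l : ℂ)‖ ^ 2) ^ (2 + β - (2 + α) / p)) *
    dirichletENorm p α (testFun l β ∘ φ)

end WeightedDirichlet

end

noncomputable section

namespace WeightedDirichlet

/-! ### Polar coordinates and the sub-mean value property -/

/-! By the chain rule and a push-forward, `∫ |(f ∘ φ)'|^p dA_α = ∫ |f'|^p dν`, where `ν =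
imageMeasure p α φ`; no injectivity of `φ` is involved. Since point evaluation at `φ 0` is
continuous, boundedness of `C_φ` says that `ν` is a Carleson measure for derivatives of functions in
`𝓓^p_α`. With `q = (2 + β) p`, the `p`-th power of the test quantity controls `(1 - |λ|²)^(q - (2 +
α)) ∫ |1 - conj λ z|^(-q) dν` for `λ` away from `0`.

Necessity in (a): the Forelli–Rudin estimate `exists_forelliRudin`, with `s = q - (2 + α) = p δ >
0`, bounds the normalised test functions in `𝓓^p_α`, and a bounded operator keeps them bounded.

Sufficiency in (a): bound `|f'(z)|^p` by its mean over the disc of radius `(1 - |z|)/2`, integrate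
against `ν` and exchange the integrals. On that disc the averaging kernel is dominated by the test
kernel (`inv_sq_le_kernel`), which gives `exists_carleson`. The estimate is localised: an annulus
near the unit circle only sees `λ` near the circle. On the remaining compact disc, pointwise bounds
and finiteness of `ν` suffice.

For (b), the normalised test functions tend to `0` pointwise as `|λ| → 1`, so a compact `C_φ` sends
them to `0` in norm. Conversely, Montel and Fatou extract from a bounded sequence a pointwise limit
lying in the space. The images converge in norm because the annulus contributes little uniformly in
`n`, and the compact disc is handled by dominated convergence. -/

lemma lintegral_ball_zero_eq_polar {f : ℂ → ℝ≥0∞} (hf : Measurable f) (R : ℝ) :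
    ∫⁻ z in Metric.ball 0 R, f z =
      ∫⁻ r in Set.Ioo 0 R, ENNReal.ofReal r *
        ∫⁻ θ in Set.Ioo (-Real.pi) Real.pi, f (circleMap 0 r θ) := by
  have hm : Measurable fun q : ℝ × ℝ => circleMap 0 q.1 q.2 := by
    unfold circleMap; fun_prop
  have hpol : ∀ q : ℝ × ℝ, Complex.polarCoord.symm q = circleMap 0 q.1 q.2 := by
    intro q
    simp [circleMap, Complex.exp_mul_I]
  rw [← lintegral_indicator Metric.isOpen_ball.measurableSet,
    ← Complex.lintegral_comp_polarCoord_symm]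
  simp_rw [hpol, smul_eq_mul]
  have hI : Measurable ((Metric.ball (0 : ℂ) R).indicator f) :=
    hf.indicator Metric.isOpen_ball.measurableSet
  rw [show polarCoord.target = Set.Ioi (0 : ℝ) ×ˢ Set.Ioo (-Real.pi) Real.pi from rfl,
    Measure.volume_eq_prod, ← Measure.prod_restrict, lintegral_prod _ (by fun_prop)]
  have h1 : ∀ r ∈ Set.Ioi (0 : ℝ), (∫⁻ θ in Set.Ioo (-Real.pi) Real.pi,
      ENNReal.ofReal r * (Metric.ball (0 : ℂ) R).indicator f (circleMap 0 r θ)) =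
      (Set.Iio R).indicator (fun r => ENNReal.ofReal r *
        ∫⁻ θ in Set.Ioo (-Real.pi) Real.pi, f (circleMap 0 r θ)) r := by
    intro r hr
    have hr' : (0 : ℝ) < r := hr
    have hmr : Measurable fun θ => f (circleMap 0 r θ) :=
      hf.comp (hm.comp (measurable_const.prodMk measurable_id))
    by_cases h : r < R
    · rw [Set.indicator_of_mem (by exact h), ← lintegral_const_mul _ hmr]
      refine lintegral_congr fun θ => ?_
      rw [Set.indicator_of_mem]
      simpa [abs_of_pos hr'] using h
    · rw [Set.indicator_of_notMem (by exact h)]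
      have : ∀ θ, (Metric.ball (0 : ℂ) R).indicator f (circleMap 0 r θ) = 0 := by
        intro θ
        rw [Set.indicator_of_notMem]
        simpa [abs_of_pos hr'] using h
      simp [this]
  rw [setLIntegral_congr_fun measurableSet_Ioi h1, setLIntegral_indicator measurableSet_Iio]
  congr 2
  ext r
  simp [and_comm]

lemma enorm_mul_two_pi_le_lintegral_circleMap {g : ℂ → ℂ} {z : ℂ} {r : ℝ} (hr : 0 < r)
    (hg : DiffContOnCl ℂ g (Metric.ball z r)) :
    ENNReal.ofReal (2 * Real.pi) * ‖g z‖ₑ ≤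
      ∫⁻ θ in Set.Ioo (-Real.pi) Real.pi, ‖g (circleMap z r θ)‖ₑ := by
  have h := DiffContOnCl.circleAverage (c := z) (R := r) (f := g) (by rwa [abs_of_pos hr])
  rw [Real.circleAverage_eq_integral_add (-Real.pi)] at h
  rw [intervalIntegral.integral_comp_add_right (fun θ => g (circleMap z r θ)),
    show 0 + -Real.pi = -Real.pi by ring, show 2 * Real.pi + -Real.pi = Real.pi by ring,
    intervalIntegral.integral_of_le (by linarith [Real.pi_pos]), integral_Ioc_eq_integral_Ioo] at h
  have h2 : (2 * Real.pi : ℝ) • g z = ∫ θ in Set.Ioo (-Real.pi) Real.pi, g (circleMap z r θ) := by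
    rw [← h, smul_smul, mul_inv_cancel₀ (by positivity), one_smul]
  calc ENNReal.ofReal (2 * Real.pi) * ‖g z‖ₑ = ‖(2 * Real.pi : ℝ) • g z‖ₑ := by
        rw [enorm_smul, Real.enorm_of_nonneg (by positivity)]
    _ ≤ _ := by
        rw [h2]
        exact enorm_integral_le_lintegral_enorm _

lemma enorm_mul_volume_ball_le {g : ℂ → ℂ} (hm : Measurable g) {z : ℂ} {R : ℝ} (hR : 0 < R)
    (hg : DifferentiableOn ℂ g (Metric.ball z R)) :
    ENNReal.ofReal (Real.pi * R ^ 2) * ‖g z‖ₑ ≤ ∫⁻ w in Metric.ball z R, ‖g w‖ₑ := by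
  have htr : ∫⁻ w in Metric.ball z R, ‖g w‖ₑ = ∫⁻ w in Metric.ball 0 R, ‖g (z + w)‖ₑ := by
    rw [← (measurePreserving_add_left (volume : Measure ℂ) z).setLIntegral_comp_preimage
      Metric.isOpen_ball.measurableSet hm.enorm]
    congr 2
    ext w
    simp
  rw [htr, lintegral_ball_zero_eq_polar (f := fun w => ‖g (z + w)‖ₑ) (by fun_prop)]
  have h1 : ∀ r ∈ Set.Ioo 0 R, ENNReal.ofReal r * (ENNReal.ofReal (2 * Real.pi) * ‖g z‖ₑ) ≤
      ENNReal.ofReal r * ∫⁻ θ in Set.Ioo (-Real.pi) Real.pi, ‖g (z + circleMap 0 r θ)‖ₑ := by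
    intro r hr
    gcongr
    have hsub : Metric.closedBall z r ⊆ Metric.ball z R := Metric.closedBall_subset_ball hr.2
    have := enorm_mul_two_pi_le_lintegral_circleMap hr.1
      (((hg.mono hsub).mono (by rw [closure_ball z hr.1.ne'])).diffContOnCl : DiffContOnCl ℂ g (Metric.ball z r))
    simpa [circleMap] using this
  refine le_trans (le_of_eq ?_) (setLIntegral_mono' measurableSet_Ioo h1)
  rw [lintegral_mul_const _ (by fun_prop), ← ofReal_integral_eq_lintegral_ofReal]
  · rw [← integral_Ioc_eq_integral_Ioo, ← intervalIntegral.integral_of_le hR.le, integral_id,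
      ← mul_assoc, ← ENNReal.ofReal_mul (by nlinarith)]
    congr 2
    ring
  · exact (continuous_id.integrableOn_Icc (a := (0 : ℝ)) (b := R)).mono_set Set.Ioo_subset_Icc_self
  · filter_upwards [ae_restrict_mem measurableSet_Ioo] with r hr using hr.1.le

/-- The area mean value inequality raised to the power `p`, by monotonicity of `L^p` norms for the
normalised area measure `P` on the ball. -/
lemma enorm_rpow_le_inv_mul_lintegral_ball {p : ℝ} (hp : 1 ≤ p) {g : ℂ → ℂ} (hm : Measurable g)
    {z : ℂ} {R : ℝ} (hR : 0 < R) (hg : DifferentiableOn ℂ g (Metric.ball z R)) :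
    ‖g z‖ₑ ^ p ≤ (ENNReal.ofReal (Real.pi * R ^ 2))⁻¹ * ∫⁻ w in Metric.ball z R, ‖g w‖ₑ ^ p := by
  have hp0 : 0 < p := by linarith
  set V := ENNReal.ofReal (Real.pi * R ^ 2) with hV
  have hV0 : V ≠ 0 := by
    rw [hV, ne_eq, ENNReal.ofReal_eq_zero, not_le]
    have := Real.pi_pos
    positivity
  have hVt : V ≠ ∞ := ENNReal.ofReal_ne_top
  have hvol : (volume : Measure ℂ) (Metric.ball z R) = V := by
    rw [Complex.volume_ball, hV, mul_comm Real.pi, ENNReal.ofReal_mul (by positivity),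
      ENNReal.ofReal_pow hR.le]
    congr 1
    rw [← ENNReal.ofReal_coe_nnreal]
    rfl
  set P : Measure ℂ := V⁻¹ • (volume : Measure ℂ).restrict (Metric.ball z R) with hP
  have hPp : IsProbabilityMeasure P := ⟨by
    rw [hP, Measure.smul_apply, Measure.restrict_apply_univ, hvol, smul_eq_mul,
      ENNReal.inv_mul_cancel hV0 hVt]⟩
  have h1 : ‖g z‖ₑ ≤ ∫⁻ w, ‖g w‖ₑ ∂P := by
    rw [hP, lintegral_smul_measure, smul_eq_mul, ← ENNReal.mul_le_iff_le_inv hV0 hVt]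
    exact enorm_mul_volume_ball_le hm hR hg
  have h2 := eLpNorm'_le_eLpNorm'_of_exponent_le (p := 1) (q := p) one_pos hp P
    hm.aestronglyMeasurable
  simp only [eLpNorm', ENNReal.rpow_one, div_one] at h2
  calc ‖g z‖ₑ ^ p ≤ ((∫⁻ w, ‖g w‖ₑ ^ p ∂P) ^ (1 / p)) ^ p := by
        gcongr
        exact h1.trans h2
    _ = ∫⁻ w, ‖g w‖ₑ ^ p ∂P := by
        rw [← ENNReal.rpow_mul, one_div_mul_cancel hp0.ne', ENNReal.rpow_one]
    _ = _ := by rw [hP, lintegral_smul_measure, smul_eq_mul]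

/-! ### The Forelli–Rudin estimate -/

/-- Split at `t = a`: the inner piece converges because `α > -1`, the outer one because `k > α + 1`.
It serves twice below, for the angular integral (exponent `0`) and for the radial one. -/
lemma lintegral_rpow_mul_max_rpow_le {α k : ℝ} (hα : -1 < α) (hk : α + 1 < k) {a : ℝ}
    (ha : 0 < a) :
    ∫⁻ t in Set.Ioi 0, ENNReal.ofReal (t ^ α * max a t ^ (-k)) ≤
      ENNReal.ofReal ((1 / (α + 1) + 1 / (k - α - 1)) * a ^ (α + 1 - k)) := by
  have hA : ∫⁻ t in Set.Ioc 0 a, ENNReal.ofReal (t ^ α * max a t ^ (-k)) =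
      ENNReal.ofReal (1 / (α + 1) * a ^ (α + 1 - k)) := by
    have : ∫⁻ t in Set.Ioc 0 a, ENNReal.ofReal (t ^ α * max a t ^ (-k)) =
        ∫⁻ t in Set.Ioc 0 a, ENNReal.ofReal (t ^ α * a ^ (-k)) :=
      setLIntegral_congr_fun measurableSet_Ioc fun t ht => by
        rw [max_eq_left ht.2]
    rw [this, ← ofReal_integral_eq_lintegral_ofReal]
    · rw [← intervalIntegral.integral_of_le ha.le, intervalIntegral.integral_mul_const,
        integral_rpow (Or.inl hα), Real.zero_rpow (by linarith)]
      congr 1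
      rw [show α + 1 - k = (α + 1) + -k by ring, Real.rpow_add ha (α + 1)]
      ring
    · exact ((intervalIntegral.intervalIntegrable_rpow' hα).1).mul_const _
    · filter_upwards [ae_restrict_mem measurableSet_Ioc] with t ht
      have := ht.1
      positivity
  have hB : ∫⁻ t in Set.Ioi a, ENNReal.ofReal (t ^ α * max a t ^ (-k)) =
      ENNReal.ofReal (1 / (k - α - 1) * a ^ (α + 1 - k)) := by
    have : ∫⁻ t in Set.Ioi a, ENNReal.ofReal (t ^ α * max a t ^ (-k)) =
        ∫⁻ t in Set.Ioi a, ENNReal.ofReal (t ^ (α - k)) :=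
      setLIntegral_congr_fun measurableSet_Ioi fun t ht => by
        rw [max_eq_right (le_of_lt ht), ← Real.rpow_add (ha.trans ht), sub_eq_add_neg]
    rw [this, ← ofReal_integral_eq_lintegral_ofReal]
    · rw [integral_Ioi_rpow_of_lt (by linarith) ha]
      congr 1
      rw [show α - k + 1 = α + 1 - k by ring, neg_div, ← div_neg,
        show -(α + 1 - k) = k - α - 1 by ring]
      ring
    · exact integrableOn_Ioi_rpow_of_lt (by linarith) ha
    · filter_upwards [ae_restrict_mem measurableSet_Ioi] with t ht
      have : 0 < t := ha.trans ht
      positivity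
  have h0 : 0 < α + 1 := by linarith
  have h1 : 0 < k - α - 1 := by linarith
  rw [← Set.Ioc_union_Ioi_eq_Ioi ha.le, add_mul, ENNReal.ofReal_add (by positivity) (by positivity),
    ← hA, ← hB]
  exact lintegral_union_le _ _ _

lemma max_le_pi_mul_norm_one_sub {ρ θ : ℝ} (h0 : 0 ≤ ρ) (h1 : ρ < 1)
    (hθ : θ ∈ Set.Ioo (-Real.pi) Real.pi) :
    max (1 - ρ) |θ| ≤ Real.pi * ‖1 - circleMap 0 ρ θ‖ := by
  have hρ : 1 - ρ ≤ ‖1 - circleMap 0 ρ θ‖ := by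
    have := norm_sub_norm_le (1 : ℂ) (circleMap 0 ρ θ)
    simpa [abs_of_nonneg h0] using this
  have hpi := Real.pi_gt_three
  refine max_le ?_ ?_
  · nlinarith
  -- Pushing the point radially to the unit circle moves it by `1 - ρ`, which is at most its
  -- distance to `1`; on the circle, `|1 - e^{iθ}| = 2 |sin (θ/2)|` and Jordan's inequality applies.
  · have h2 : ‖1 - circleMap 0 1 θ‖ ≤ 2 * ‖1 - circleMap 0 ρ θ‖ := by
      have h3 : (1 : ℂ) - circleMap 0 1 θ =
          (1 - circleMap 0 ρ θ) - ((1 - ρ : ℝ) : ℂ) * circleMap 0 1 θ := by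
        simp [circleMap]; ring
      rw [h3]
      refine (norm_sub_le _ _).trans ?_
      rw [norm_mul, Complex.norm_real, Real.norm_of_nonneg (by linarith), norm_circleMap_zero]
      simp only [abs_one, mul_one]
      linarith
    have h4 : 2 / Real.pi * |θ| ≤ ‖1 - circleMap 0 1 θ‖ := by
      have h5 : ‖1 - circleMap 0 1 θ‖ = ‖2 * Real.sin (θ / 2)‖ := by
        rw [norm_sub_rev, ← Complex.norm_exp_I_mul_ofReal_sub_one]
        simp [circleMap, mul_comm]
      rw [h5, norm_mul, Real.norm_two, Real.norm_eq_abs]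
      have h6 : |θ / 2| ≤ Real.pi / 2 := by
        rw [abs_le]; constructor <;> linarith [hθ.1, hθ.2]
      have := Real.mul_abs_le_abs_sin h6
      rw [abs_div, abs_two] at this
      calc 2 / Real.pi * |θ| = 2 * (2 / Real.pi * (|θ| / 2)) := by ring
        _ ≤ _ := by gcongr
    have h7 : 2 / Real.pi * |θ| ≤ 2 * ‖1 - circleMap 0 ρ θ‖ := h4.trans h2
    rw [div_mul_eq_mul_div, div_le_iff₀ Real.pi_pos] at h7
    linarith

lemma lintegral_norm_one_sub_circleMap_rpow_le {c : ℝ} (hc : 1 < c) {ρ : ℝ} (h0 : 0 ≤ ρ)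
    (h1 : ρ < 1) :
    ∫⁻ θ in Set.Ioo (-Real.pi) Real.pi, ENNReal.ofReal (‖1 - circleMap 0 ρ θ‖ ^ (-c)) ≤
      ENNReal.ofReal (2 * Real.pi ^ c * (1 + 1 / (c - 1)) * (1 - ρ) ^ (1 - c)) := by
  have ha : 0 < 1 - ρ := by linarith
  have hpi := Real.pi_pos
  set h : ℝ → ℝ≥0∞ := (Set.Ici 0).indicator
    fun t => ENNReal.ofReal (max (1 - ρ) t ^ (-c)) with hh
  have hhm : Measurable h := Measurable.indicator (by fun_prop) measurableSet_Ici
  have hhI : ∫⁻ t, h t ≤ ENNReal.ofReal ((1 + 1 / (c - 1)) * (1 - ρ) ^ (1 - c)) := by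
    rw [hh, lintegral_indicator measurableSet_Ici, setLIntegral_congr Ioi_ae_eq_Ici.symm]
    have := lintegral_rpow_mul_max_rpow_le (α := 0) (k := c) (by norm_num) (by linarith) ha
    simpa using this
  -- `h` lives on the half-line `t ≥ 0`, so adding its reflection covers both signs of `θ` and
  -- reduces the angular integral to the one-variable estimate.
  have hle : ∀ θ ∈ Set.Ioo (-Real.pi) Real.pi, ENNReal.ofReal (‖1 - circleMap 0 ρ θ‖ ^ (-c)) ≤
      ENNReal.ofReal (Real.pi ^ c) * (h θ + h (-θ)) := by
    intro θ hθ
    have hm := max_le_pi_mul_norm_one_sub h0 h1 hθ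
    have hmp : 0 < max (1 - ρ) |θ| := lt_max_of_lt_left ha
    have h2 : ‖1 - circleMap 0 ρ θ‖ ^ (-c) ≤ Real.pi ^ c * max (1 - ρ) |θ| ^ (-c) := by
      have h3 : max (1 - ρ) |θ| / Real.pi ≤ ‖1 - circleMap 0 ρ θ‖ := by
        rw [div_le_iff₀ hpi]; linarith
      calc ‖1 - circleMap 0 ρ θ‖ ^ (-c) ≤ (max (1 - ρ) |θ| / Real.pi) ^ (-c) :=
            Real.rpow_le_rpow_of_nonpos (by positivity) h3 (by linarith)
        _ = _ := by
            rw [Real.div_rpow hmp.le hpi.le, Real.rpow_neg hpi.le, div_inv_eq_mul, mul_comm]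
    have h4 : ENNReal.ofReal (max (1 - ρ) |θ| ^ (-c)) ≤ h θ + h (-θ) := by
      rcases le_total 0 θ with ht | ht
      · refine le_add_right ?_
        rw [hh, Set.indicator_of_mem (by exact ht), abs_of_nonneg ht]
      · refine le_add_left ?_
        rw [hh, Set.indicator_of_mem (by simpa using ht), abs_of_nonpos ht]
    refine (ENNReal.ofReal_le_ofReal h2).trans ?_
    rw [ENNReal.ofReal_mul (by positivity)]
    gcongr
  calc _ ≤ ∫⁻ θ in Set.Ioo (-Real.pi) Real.pi, ENNReal.ofReal (Real.pi ^ c) * (h θ + h (-θ)) :=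
        setLIntegral_mono' measurableSet_Ioo hle
    _ ≤ ∫⁻ θ, ENNReal.ofReal (Real.pi ^ c) * (h θ + h (-θ)) := setLIntegral_le_lintegral _ _
    _ = ENNReal.ofReal (Real.pi ^ c) * ((∫⁻ t, h t) + ∫⁻ t, h t) := by
        rw [lintegral_const_mul _ (by fun_prop), lintegral_add_left hhm, lintegral_neg_eq_self]
    _ ≤ ENNReal.ofReal (Real.pi ^ c) * (2 * ENNReal.ofReal ((1 + 1 / (c - 1)) * (1 - ρ) ^ (1 - c))) := by
        rw [two_mul]; gcongr
    _ = _ := by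
        rw [← ENNReal.ofReal_ofNat, ← ENNReal.ofReal_mul (by norm_num),
          ← ENNReal.ofReal_mul (by positivity)]
        congr 1
        ring

lemma lintegral_weightedArea (α : ℝ) {f : ℂ → ℝ≥0∞} (hf : Measurable f) :
    ∫⁻ z, f z ∂(weightedArea α) = ∫⁻ z in Metric.ball 0 1,
      ENNReal.ofReal ((1 + α) * (1 - ‖z‖ ^ 2) ^ α / Real.pi) * f z := by
  rw [weightedArea, lintegral_withDensity_eq_lintegral_mul _ (by fun_prop) hf]
  rfl

lemma lintegral_weightedArea_comp_rotation (α : ℝ) (a : Circle) {f : ℂ → ℝ≥0∞}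
    (hf : Measurable f) :
    ∫⁻ z, f (a * z) ∂(weightedArea α) = ∫⁻ z, f z ∂(weightedArea α) := by
  rw [lintegral_weightedArea α hf, lintegral_weightedArea α (by fun_prop)]
  have hmp : MeasurePreserving (fun z : ℂ => (a : ℂ) * z) volume volume :=
    (rotation a).measurePreserving
  have hpre : (fun z : ℂ => (a : ℂ) * z) ⁻¹' Metric.ball 0 1 = Metric.ball 0 1 := by
    ext z
    simp [Circle.norm_coe a]
  rw [← hmp.setLIntegral_comp_preimage Metric.isOpen_ball.measurableSet
    (f := fun z => ENNReal.ofReal ((1 + α) * (1 - ‖z‖ ^ 2) ^ α / Real.pi) * f z) (by fun_prop), hpre]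
  simp [Circle.norm_coe a]

lemma one_sub_sq_rpow_le {α r : ℝ} (h0 : 0 ≤ r) (h1 : r < 1) :
    (1 - r ^ 2) ^ α ≤ 2 ^ |α| * (1 - r) ^ α := by
  rw [show 1 - r ^ 2 = (1 + r) * (1 - r) by ring, Real.mul_rpow (by linarith) (by linarith)]
  have : 0 < 1 - r := by linarith
  gcongr
  calc (1 + r) ^ α ≤ (1 + r) ^ |α| := Real.rpow_le_rpow_of_exponent_le (by linarith) (le_abs_self α)
    _ ≤ _ := Real.rpow_le_rpow (by linarith) (by linarith) (abs_nonneg α)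

/-- Rotation invariance makes `l` real and nonnegative. In polar coordinates the angular integral is
of order `(1 - ρ r)^(-(1 + α + s))`, and after `t = 1 - r` the radial one is the model integral with
`a = 1 - ρ` and `k = 1 + α + s`, whence the power `-s`. -/
lemma exists_forelliRudin {α s : ℝ} (hα : -1 < α) (hs : 0 < s) :
    ∃ C : ℝ, 0 ≤ C ∧ ∀ l : ℂ, ‖l‖ < 1 →
      ∫⁻ z, ENNReal.ofReal (‖1 - conj l * z‖ ^ (-(2 + α + s))) ∂(weightedArea α) ≤
        ENNReal.ofReal (C * (1 - ‖l‖) ^ (-s)) := by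
  set c := 2 + α + s with hc
  have hc1 : 1 < c := by linarith
  have hpi := Real.pi_pos
  have hα1 : 0 < 1 + α := by linarith
  have hα2 : 0 < α + 1 := by linarith
  have hc2 : 0 < c - 1 := by linarith
  set A := (1 + α) * 2 ^ |α| / Real.pi with hA
  set B := 2 * Real.pi ^ c * (1 + 1 / (c - 1)) with hB
  have hA0 : 0 ≤ A := by positivity
  have hB0 : 0 ≤ B := by positivity
  refine ⟨A * B * (1 / (α + 1) + 1 / s), by positivity, fun l hl => ?_⟩
  set ρ := ‖l‖ with hρ
  have hρ0 : 0 ≤ ρ := norm_nonneg l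
  have ha : 0 < 1 - ρ := by linarith
  have hrot : ∫⁻ z, ENNReal.ofReal (‖1 - conj l * z‖ ^ (-c)) ∂(weightedArea α) =
      ∫⁻ z, ENNReal.ofReal (‖1 - ρ * z‖ ^ (-c)) ∂(weightedArea α) := by
    rw [← lintegral_weightedArea_comp_rotation α (Circle.exp l.arg) (by fun_prop)]
    refine lintegral_congr fun z => ?_
    have h1 : conj l * (Circle.exp l.arg : ℂ) = ρ := by
      conv_lhs => rw [← Complex.norm_mul_exp_arg_mul_I l]
      rw [map_mul, Complex.conj_ofReal, ← Complex.exp_conj, Circle.coe_exp, mul_assoc,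
        ← Complex.exp_add]
      simp [hρ]
    rw [← mul_assoc, h1]
  have hradial : ∀ r ∈ Set.Ioo (0 : ℝ) 1,
      ENNReal.ofReal r * ∫⁻ θ in Set.Ioo (-Real.pi) Real.pi,
        ENNReal.ofReal ((1 + α) * (1 - ‖circleMap 0 r θ‖ ^ 2) ^ α / Real.pi) *
          ENNReal.ofReal (‖1 - ρ * circleMap 0 r θ‖ ^ (-c)) ≤
      ENNReal.ofReal (A * B) *
        ENNReal.ofReal ((1 - r) ^ α * max (1 - ρ) (1 - r) ^ (-(1 + α + s))) := by
    intro r hr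
    have hr1 : 0 < 1 - r := by linarith [hr.2]
    have h1r : 0 < 1 - ρ * r := by nlinarith [hr.1, hr.2]
    have hcm : ∀ θ, (ρ : ℂ) * circleMap 0 r θ = circleMap 0 (ρ * r) θ := by
      intro θ; simp [circleMap]; ring
    simp_rw [norm_circleMap_zero, abs_of_pos hr.1, hcm]
    rw [lintegral_const_mul _ (by unfold circleMap; fun_prop)]
    have h1 : ENNReal.ofReal r ≤ 1 := by simpa using hr.2.le
    have h2 : (1 + α) * (1 - r ^ 2) ^ α / Real.pi ≤ A * (1 - r) ^ α := by
      calc _ ≤ (1 + α) * (2 ^ |α| * (1 - r) ^ α) / Real.pi := by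
            gcongr
            exact one_sub_sq_rpow_le hr.1.le hr.2
        _ = _ := by rw [hA]; ring
    -- Both `1 - ρ` and `1 - r` are at most `1 - ρ r`, and the exponent is negative.
    have h3 : (1 - ρ * r) ^ (1 - c) ≤ max (1 - ρ) (1 - r) ^ (-(1 + α + s)) := by
      rw [show 1 - c = -(1 + α + s) by rw [hc]; ring]
      refine Real.rpow_le_rpow_of_nonpos (lt_max_of_lt_left ha) (max_le ?_ ?_) (by linarith)
      · nlinarith [hr.2]
      · nlinarith [hr.1]
    calc _ ≤ 1 * (ENNReal.ofReal (A * (1 - r) ^ α) * ENNReal.ofReal (B * (1 - ρ * r) ^ (1 - c))) := by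
          gcongr
          exact lintegral_norm_one_sub_circleMap_rpow_le hc1 (mul_nonneg hρ0 hr.1.le) (by linarith)
      _ ≤ ENNReal.ofReal (A * (1 - r) ^ α) *
          ENNReal.ofReal (B * max (1 - ρ) (1 - r) ^ (-(1 + α + s))) := by
          rw [one_mul]
          gcongr
      _ = _ := by
          rw [← ENNReal.ofReal_mul (by positivity), ← ENNReal.ofReal_mul (by positivity)]
          congr 1
          ring
  have hsub : ∀ h : ℝ → ℝ≥0∞, ∫⁻ r in Set.Ioo (0 : ℝ) 1, h (1 - r) = ∫⁻ t in Set.Ioo (0 : ℝ) 1, h t := by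
    intro h
    rw [← lintegral_indicator measurableSet_Ioo, ← lintegral_indicator measurableSet_Ioo,
      ← lintegral_sub_left_eq_self ((Set.Ioo (0 : ℝ) 1).indicator h) (1 : ℝ)]
    refine lintegral_congr fun r => ?_
    by_cases hr : r ∈ Set.Ioo (0 : ℝ) 1
    · rw [Set.indicator_of_mem hr, Set.indicator_of_mem (Set.mem_Ioo.2
        ⟨by linarith [hr.2], by linarith [hr.1]⟩)]
    · rw [Set.indicator_of_notMem hr, Set.indicator_of_notMem]
      exact fun h => hr ⟨by linarith [h.2], by linarith [h.1]⟩
  rw [hrot, lintegral_weightedArea α (by fun_prop),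
    lintegral_ball_zero_eq_polar (by fun_prop)]
  refine (setLIntegral_mono' measurableSet_Ioo hradial).trans ?_
  rw [lintegral_const_mul _ (by fun_prop),
    hsub (fun t => ENNReal.ofReal (t ^ α * max (1 - ρ) t ^ (-(1 + α + s))))]
  have := lintegral_rpow_mul_max_rpow_le (α := α) (k := 1 + α + s) hα (by linarith) ha
  rw [show 1 + α + s - α - 1 = s by ring, show α + 1 - (1 + α + s) = -s by ring] at this
  calc _ ≤ ENNReal.ofReal (A * B) *
        ∫⁻ t in Set.Ioi 0, ENNReal.ofReal (t ^ α * max (1 - ρ) t ^ (-(1 + α + s))) := by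
        gcongr
        exact Set.Ioo_subset_Ioi_self
    _ ≤ _ := mul_le_mul_right this _
    _ = _ := by
        rw [← ENNReal.ofReal_mul (by positivity)]
        congr 1
        ring

/-! ### Pointwise estimates and Carleson measures -/

/-- The ball of radius `(1 - R)/2` about `z` stays in `‖w‖ ≤ (1 + R)/2`, where the density of
`weightedArea α` is at least `c`. The exponent `|α|` makes this lower bound valid for either sign of
`α`. -/
lemma exists_enorm_rpow_le_of_norm_le {p α : ℝ} (hp : 1 ≤ p) (hα : -1 < α) {R : ℝ} (hR0 : 0 ≤ R)
    (hR : R < 1) :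
    ∃ C : ℝ≥0∞, C ≠ ∞ ∧ ∀ g : ℂ → ℂ, Measurable g → DifferentiableOn ℂ g (Metric.ball 0 1) →
      ∀ z : ℂ, ‖z‖ ≤ R → ‖g z‖ₑ ^ p ≤ C * ∫⁻ w, ‖g w‖ₑ ^ p ∂(weightedArea α) := by
  set r := (1 - R) / 2 with hr
  have hr0 : 0 < r := by rw [hr]; linarith
  set t := 1 - ((1 + R) / 2) ^ 2 with ht
  have ht0 : 0 < t := by rw [ht]; nlinarith
  have hpi := Real.pi_pos
  have hα1 : 0 < 1 + α := by linarith
  set c := (1 + α) * t ^ |α| / Real.pi with hc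
  have hc0 : 0 < c := by positivity
  refine ⟨(ENNReal.ofReal (Real.pi * r ^ 2))⁻¹ * (ENNReal.ofReal c)⁻¹, ?_, fun g hm hg z hz => ?_⟩
  · refine ENNReal.mul_ne_top ?_ ?_ <;> rw [ENNReal.inv_ne_top, ne_eq, ENNReal.ofReal_eq_zero, not_le]
      <;> positivity
  have hsub : Metric.ball z r ⊆ Metric.ball 0 1 := by
    intro w hw
    rw [mem_ball_iff_norm] at hw
    rw [mem_ball_zero_iff]
    have := norm_le_norm_add_norm_sub z w
    rw [norm_sub_rev] at this
    linarith
  refine (enorm_rpow_le_inv_mul_lintegral_ball hp hm hr0 (hg.mono hsub)).trans ?_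
  rw [mul_assoc]
  gcongr
  rw [← ENNReal.mul_le_iff_le_inv (by simpa using hc0) ENNReal.ofReal_ne_top,
    ← lintegral_const_mul _ (by fun_prop), lintegral_weightedArea α (by fun_prop)]
  refine (setLIntegral_mono' Metric.isOpen_ball.measurableSet fun w hw => ?_).trans
    (lintegral_mono_set hsub)
  gcongr
  rw [mem_ball_iff_norm] at hw
  have hw1 : ‖w‖ ≤ (1 + R) / 2 := by
    have := norm_le_norm_add_norm_sub z w
    rw [norm_sub_rev] at this
    linarith
  have hw0 := norm_nonneg w
  have htw : t ≤ 1 - ‖w‖ ^ 2 := by rw [ht]; nlinarith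
  rw [hc]
  gcongr
  calc t ^ |α| ≤ (1 - ‖w‖ ^ 2) ^ |α| := Real.rpow_le_rpow ht0.le htw (abs_nonneg α)
    _ ≤ _ := Real.rpow_le_rpow_of_exponent_ge (by linarith) (by nlinarith) (le_abs_self α)

lemma one_sub_rpow_le {a r : ℝ} (h0 : 0 ≤ r) (h1 : r < 1) :
    (1 - r) ^ a ≤ 2 ^ |a| * (1 - r ^ 2) ^ a := by
  have h2 : 0 < 1 - r := by linarith
  have h3 : (1 + r) ^ (-a) ≤ 2 ^ |a| :=
    calc (1 + r) ^ (-a) ≤ (1 + r) ^ |a| :=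
          Real.rpow_le_rpow_of_exponent_le (by linarith) (neg_le_abs a)
      _ ≤ _ := Real.rpow_le_rpow (by linarith) (by linarith) (abs_nonneg a)
  rw [show 1 - r ^ 2 = (1 + r) * (1 - r) by ring, Real.mul_rpow (by linarith) (by linarith),
    ← mul_assoc]
  refine le_mul_of_one_le_left (by positivity) ?_
  calc (1 : ℝ) = (1 + r) ^ (-a) * (1 + r) ^ a := by
        rw [← Real.rpow_add (by linarith)]; simp
    _ ≤ _ := by gcongr

/-- On the disc around `z`, `|w - z| < 1 - |w|`, hence `|1 - conj w z| ≤ (1 - |w|²) + |w| |w - z| ≤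
3 (1 - |w|)`: this gives `3 ^ q`. The `9` comes from `1 - |w| ≤ 3 (1 - |z|)/2`, and `2 ^ |q - 2|`
from trading `1 - |w|` for `1 - |w|²`. The right side is arranged as density times test kernel, with
`w` in the role of `λ`. -/
lemma inv_sq_le_kernel {α q : ℝ} (hα : -1 < α) (hq : 0 ≤ q) {z w : ℂ}
    (h : dist w z < (1 - ‖z‖) / 2) :
    (Real.pi * ((1 - ‖z‖) / 2) ^ 2)⁻¹ ≤ 9 * 3 ^ q * 2 ^ |q - 2| / (1 + α) *
      ((1 + α) * (1 - ‖w‖ ^ 2) ^ α / Real.pi) * (1 - ‖w‖ ^ 2) ^ (q - (2 + α)) *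
        ‖1 - conj w * z‖ ^ (-q) := by
  rw [dist_eq_norm] at h
  have hpi := Real.pi_pos
  have hα1 : 0 < 1 + α := by linarith
  have hzw : ‖z‖ ≤ ‖w‖ + ‖w - z‖ := norm_le_norm_add_norm_sub w z
  have hwz : ‖w‖ ≤ ‖z‖ + ‖w - z‖ := norm_sub_rev w z ▸ norm_le_norm_add_norm_sub z w
  have hz0 := norm_nonneg z
  have hw0 := norm_nonneg w
  have hd0 := norm_nonneg (w - z)
  have hx : 0 < 1 - ‖w‖ := by linarith
  have hX : 0 < 1 - ‖w‖ ^ 2 := by nlinarith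
  have hker : ‖1 - conj w * z‖ ≤ 3 * (1 - ‖w‖) := by
    have h1 : (1 : ℂ) - conj w * z = ((1 - ‖w‖ ^ 2 : ℝ) : ℂ) + conj w * (w - z) := by
      have : conj w * w = ((‖w‖ ^ 2 : ℝ) : ℂ) := by
        rw [Complex.conj_mul']; push_cast; rfl
      rw [mul_sub, this]; push_cast; ring
    rw [h1]
    refine (norm_add_le _ _).trans ?_
    rw [norm_mul, Complex.norm_real, Real.norm_of_nonneg hX.le, RCLike.norm_conj]
    nlinarith
  have hker0 : 0 < ‖1 - conj w * z‖ := by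
    have h1 := norm_sub_norm_le (1 : ℂ) (conj w * z)
    rw [norm_mul, RCLike.norm_conj, norm_one] at h1
    nlinarith
  have h1 : (Real.pi * ((1 - ‖z‖) / 2) ^ 2)⁻¹ ≤ 9 / Real.pi * (1 - ‖w‖) ^ (-2 : ℝ) := by
    rw [Real.rpow_neg hx.le, Real.rpow_two, div_mul_eq_mul_div, ← div_eq_mul_inv, div_div,
      inv_eq_one_div, div_le_div_iff₀ (by have : 0 < 1 - ‖z‖ := by linarith
                                          positivity) (by positivity)]
    have : (1 - ‖w‖) ^ 2 ≤ 9 * ((1 - ‖z‖) / 2) ^ 2 := by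
      nlinarith
    nlinarith
  have h2 : 1 ≤ 3 ^ q * (1 - ‖w‖) ^ q * ‖1 - conj w * z‖ ^ (-q) := by
    rw [← Real.mul_rpow (by norm_num) hx.le, Real.rpow_neg hker0.le, ← div_eq_mul_inv,
      one_le_div (by positivity)]
    exact Real.rpow_le_rpow hker0.le hker hq
  have h3 := one_sub_rpow_le (a := q - 2) hw0 (by linarith)
  calc (Real.pi * ((1 - ‖z‖) / 2) ^ 2)⁻¹ ≤ 9 / Real.pi * (1 - ‖w‖) ^ (-2 : ℝ) := h1
    _ ≤ 9 / Real.pi * (1 - ‖w‖) ^ (-2 : ℝ) *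
        (3 ^ q * (1 - ‖w‖) ^ q * ‖1 - conj w * z‖ ^ (-q)) :=
        le_mul_of_one_le_right (by positivity) h2
    _ = 9 / Real.pi * 3 ^ q * (1 - ‖w‖) ^ (q - 2) * ‖1 - conj w * z‖ ^ (-q) := by
        rw [sub_eq_add_neg q 2, Real.rpow_add hx]; ring
    _ ≤ 9 / Real.pi * 3 ^ q * (2 ^ |q - 2| * (1 - ‖w‖ ^ 2) ^ (q - 2)) *
        ‖1 - conj w * z‖ ^ (-q) := by gcongr
    _ = _ := by
        rw [show q - 2 = α + (q - (2 + α)) by ring, Real.rpow_add hX]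
        field_simp

/-- Average over discs, then use Tonelli. The constant depends on none of `ν`, `ρ`, `R`, `ε`, so one
estimate serves both boundedness and compactness. -/
lemma exists_carleson {p α q : ℝ} (hp : 1 ≤ p) (hα : -1 < α) (hq : 0 ≤ q) :
    ∃ C : ℝ≥0∞, C ≠ ∞ ∧ ∀ (ν : Measure ℂ) [SFinite ν] (ρ R : ℝ) (ε : ℝ≥0∞),
      ρ ≤ 1 - 3 / 2 * (1 - R) →
      (∀ w : ℂ, ρ ≤ ‖w‖ → ‖w‖ < 1 → ENNReal.ofReal ((1 - ‖w‖ ^ 2) ^ (q - (2 + α))) *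
        ∫⁻ z, ENNReal.ofReal (‖1 - conj w * z‖ ^ (-q)) ∂ν ≤ ε) →
      ∀ g : ℂ → ℂ, Measurable g → DifferentiableOn ℂ g (Metric.ball 0 1) →
        ∫⁻ z in {z | R ≤ ‖z‖ ∧ ‖z‖ < 1}, ‖g z‖ₑ ^ p ∂ν ≤
          C * ε * ∫⁻ w, ‖g w‖ₑ ^ p ∂(weightedArea α) := by
  set c := 9 * 3 ^ q * 2 ^ |q - 2| / (1 + α) with hc
  have hα1 : 0 < 1 + α := by linarith
  have hc0 : 0 ≤ c := by positivity
  have hpi := Real.pi_pos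
  refine ⟨ENNReal.ofReal c, ENNReal.ofReal_ne_top, fun ν _ ρ R ε hρR hε g hm hg => ?_⟩
  set S : Set ℂ := {z | R ≤ ‖z‖ ∧ ‖z‖ < 1} with hS
  have hSm : MeasurableSet S :=
    (measurableSet_le measurable_const measurable_norm).inter
      (measurableSet_lt measurable_norm measurable_const)
  set U : Set (ℂ × ℂ) := {x | dist x.2 x.1 < (1 - ‖x.1‖) / 2} with hU
  have hUm : MeasurableSet U := measurableSet_lt (by fun_prop) (by fun_prop)
  -- `F (z, ·)` is the normalised average of `|g|^p` over the disc of radius `(1 - |z|)/2` about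
  -- `z`, written on the product space for the exchange of integrals.
  set F : ℂ × ℂ → ℝ≥0∞ := U.indicator fun x =>
    ENNReal.ofReal ((Real.pi * ((1 - ‖x.1‖) / 2) ^ 2)⁻¹) * ‖g x.2‖ₑ ^ p with hF
  have hFm : Measurable F := Measurable.indicator (by fun_prop) hUm
  have h1 : ∀ z ∈ S, ‖g z‖ₑ ^ p ≤ ∫⁻ w, F (z, w) := by
    intro z hz
    have hr : 0 < (1 - ‖z‖) / 2 := by linarith [hz.2]
    have hsub : Metric.ball z ((1 - ‖z‖) / 2) ⊆ Metric.ball 0 1 := by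
      intro w hw
      rw [mem_ball_iff_norm] at hw
      rw [mem_ball_zero_iff]
      have := norm_le_norm_add_norm_sub z w
      rw [norm_sub_rev] at this
      linarith
    refine (enorm_rpow_le_inv_mul_lintegral_ball hp hm hr (hg.mono hsub)).trans (le_of_eq ?_)
    rw [← lintegral_const_mul _ (by fun_prop), ← lintegral_indicator Metric.isOpen_ball.measurableSet,
      ← ENNReal.ofReal_inv_of_pos (by positivity)]
    rfl
  have h2 : ∀ w, ∫⁻ z in S, F (z, w) ∂ν ≤ (Metric.ball (0 : ℂ) 1).indicator (fun w =>
      ENNReal.ofReal c * ε * (ENNReal.ofReal ((1 + α) * (1 - ‖w‖ ^ 2) ^ α / Real.pi) *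
        ‖g w‖ₑ ^ p)) w := by
    intro w
    by_cases hw : ρ ≤ ‖w‖ ∧ ‖w‖ < 1
    · have hX : 0 < 1 - ‖w‖ ^ 2 := by nlinarith [norm_nonneg w]
      rw [Set.indicator_of_mem (by simpa using hw.2)]
      have h3 : ∀ z, F (z, w) ≤ ENNReal.ofReal (c * ((1 + α) * (1 - ‖w‖ ^ 2) ^ α / Real.pi) *
          (1 - ‖w‖ ^ 2) ^ (q - (2 + α))) * ‖g w‖ₑ ^ p * ENNReal.ofReal (‖1 - conj w * z‖ ^ (-q)) := by
        intro z
        by_cases hzw : (z, w) ∈ U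
        · rw [hF, Set.indicator_of_mem hzw, mul_right_comm, ← ENNReal.ofReal_mul (by positivity)]
          gcongr
          exact inv_sq_le_kernel hα hq hzw
        · rw [hF, Set.indicator_of_notMem hzw]
          exact zero_le
      calc ∫⁻ z in S, F (z, w) ∂ν ≤ ∫⁻ z, F (z, w) ∂ν := setLIntegral_le_lintegral _ _
        _ ≤ _ := lintegral_mono h3
        _ = ENNReal.ofReal c * (ENNReal.ofReal ((1 - ‖w‖ ^ 2) ^ (q - (2 + α))) *
            ∫⁻ z, ENNReal.ofReal (‖1 - conj w * z‖ ^ (-q)) ∂ν) *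
            (ENNReal.ofReal ((1 + α) * (1 - ‖w‖ ^ 2) ^ α / Real.pi) * ‖g w‖ₑ ^ p) := by
          rw [lintegral_const_mul _ (by fun_prop), ENNReal.ofReal_mul (by positivity),
            ENNReal.ofReal_mul (by positivity)]
          ring
        _ ≤ _ := by
          gcongr
          exact hε w hw.1 hw.2
    -- If `w` lies in the disc about some `z` with `|z| ≥ R`, then `1 - |w| < 3/2 (1 - |z|) ≤ 3/2 (1
    -- - R)`, so `|w| ≥ ρ`; other `w` contribute nothing.
    · have h3 : ∀ z ∈ S, F (z, w) = 0 := by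
        intro z hz
        rw [hF, Set.indicator_of_notMem]
        intro hzw
        have hd : dist w z < (1 - ‖z‖) / 2 := hzw
        rw [dist_eq_norm] at hd
        have hzw' : ‖z‖ ≤ ‖w‖ + ‖w - z‖ := norm_le_norm_add_norm_sub w z
        have hwz : ‖w‖ ≤ ‖z‖ + ‖w - z‖ := norm_sub_rev w z ▸ norm_le_norm_add_norm_sub z w
        exact hw ⟨by linarith [hz.1], by linarith [hz.2]⟩
      rw [setLIntegral_congr_fun hSm h3]
      simp
  calc ∫⁻ z in S, ‖g z‖ₑ ^ p ∂ν ≤ ∫⁻ z in S, (∫⁻ w, F (z, w)) ∂ν := setLIntegral_mono' hSm h1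
    _ = ∫⁻ w, ∫⁻ z in S, F (z, w) ∂ν := 
        lintegral_lintegral_swap (f := fun z w => F (z, w)) hFm.aemeasurable
    _ ≤ _ := lintegral_mono h2
    _ = _ := by
        rw [lintegral_indicator Metric.isOpen_ball.measurableSet,
          lintegral_const_mul _ (by fun_prop), lintegral_weightedArea α (by fun_prop)]

/-! ### The norm and point evaluations -/

lemma IsHolo.differentiableOn_derivDisc {f : 𝔻 → ℂ} (hf : IsHolo f) :
    DifferentiableOn ℂ (derivDisc f) (Metric.ball 0 1) :=
  DifferentiableOn.deriv hf Metric.isOpen_ball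

lemma dirichletENorm_rpow {p : ℝ} (hp : 1 ≤ p) (α : ℝ) (f : 𝔻 → ℂ) :
    dirichletENorm p α f ^ p = ‖f 0‖ₑ ^ p + ∫⁻ z, ‖derivDisc f z‖ₑ ^ p ∂(weightedArea α) := by
  have hp0 : p ≠ 0 := by positivity
  rw [dirichletENorm, ← ENNReal.rpow_mul, one_div_mul_cancel hp0, ENNReal.rpow_one]

lemma lintegral_derivDisc_le {p : ℝ} (hp : 1 ≤ p) (α : ℝ) (f : 𝔻 → ℂ) :
    ∫⁻ z, ‖derivDisc f z‖ₑ ^ p ∂(weightedArea α) ≤ dirichletENorm p α f ^ p := by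
  rw [dirichletENorm_rpow hp]
  exact le_add_self

lemma exists_enorm_le_dirichletENorm {p α : ℝ} (hp : 1 ≤ p) (hα : -1 < α) {R : ℝ} (hR0 : 0 ≤ R)
    (hR : R < 1) :
    ∃ C : ℝ≥0∞, C ≠ ∞ ∧ ∀ f : 𝔻 → ℂ, MemDirichlet p α f → ∀ z : ℂ, ‖z‖ ≤ R →
      ‖derivDisc f z‖ₑ ≤ C * dirichletENorm p α f ∧
      ‖extendZero f z‖ₑ ≤ C * dirichletENorm p α f := by
  have hp0 : 0 < p := by linarith
  obtain ⟨C, hC, h⟩ := exists_enorm_rpow_le_of_norm_le hp hα hR0 hR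
  have hC' : C ^ (1 / p) ≠ ∞ := ENNReal.rpow_ne_top_of_nonneg (by positivity) hC
  refine ⟨1 + C ^ (1 / p), by finiteness, fun f hf => ?_⟩
  set N := dirichletENorm p α f with hN
  have hd : ∀ w : ℂ, ‖w‖ ≤ R → ‖derivDisc f w‖ₑ ≤ C ^ (1 / p) * N := by
    intro w hw
    have h1 := (h _ (measurable_derivDisc f) hf.1.differentiableOn_derivDisc w hw).trans
      (mul_le_mul_right (lintegral_derivDisc_le hp α f) C)
    have h2 := ENNReal.rpow_le_rpow h1 (show 0 ≤ 1 / p by positivity)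
    rwa [ENNReal.mul_rpow_of_nonneg _ _ (by positivity), ← ENNReal.rpow_mul, ← ENNReal.rpow_mul,
      mul_one_div_cancel hp0.ne', ENNReal.rpow_one, ENNReal.rpow_one] at h2
  have h0 : ‖f 0‖ₑ ≤ N := by
    rw [← ENNReal.rpow_le_rpow_iff hp0, hN, dirichletENorm_rpow hp]
    exact le_self_add
  have hB : C ^ (1 / p) * N ≠ ∞ := ENNReal.mul_ne_top hC' hf.2.ne
  intro z hz
  refine ⟨(hd z hz).trans (by gcongr; exact le_add_self), ?_⟩
  -- The values of `f` follow from those of `f'` by the mean value inequality along the segment from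
  -- `0`.
  have hdiff : ‖extendZero f z - extendZero f 0‖ ≤ (C ^ (1 / p) * N).toReal * ‖z - 0‖ := by
    refine (convex_closedBall (0 : ℂ) R).norm_image_sub_le_of_norm_deriv_le (𝕜 := ℂ)
      (fun w hw => hf.1.differentiableAt ?_) (fun w hw => ?_) (by simpa using hR0) (by simpa using hz)
    · simp only [Metric.mem_closedBall, dist_zero_right] at hw
      simpa using hw.trans_lt hR
    · rw [← ENNReal.ofReal_le_iff_le_toReal hB, ofReal_norm]
      exact hd w (by simpa using hw)
  have hdiff' : ‖extendZero f z - extendZero f 0‖ₑ ≤ C ^ (1 / p) * N := by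
    rw [← ofReal_norm, ENNReal.ofReal_le_iff_le_toReal hB]
    refine hdiff.trans (mul_le_of_le_one_right ENNReal.toReal_nonneg ?_)
    rw [sub_zero]
    linarith
  have h00 : extendZero f 0 = f 0 := extendZero_coe f 0
  calc ‖extendZero f z‖ₑ = ‖f 0 + (extendZero f z - extendZero f 0)‖ₑ := by rw [h00]; congr 1; ring
    _ ≤ ‖f 0‖ₑ + ‖extendZero f z - extendZero f 0‖ₑ := enorm_add_le _ _
    _ ≤ N + C ^ (1 / p) * N := add_le_add h0 hdiff'
    _ = _ := by ring

/-! ### Composition with a self-map of the disc -/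

lemma extendZero_mk (f : 𝔻 → ℂ) {z : ℂ} (hz : ‖z‖ < 1) :
    extendZero f z = f (Complex.UnitDisc.mk z hz) := by
  simp [extendZero, hz]

lemma norm_extendZero_selfMap_lt_one (φ : 𝔻 → 𝔻) (z : ℂ) :
    ‖extendZero (fun z => (φ z : ℂ)) z‖ < 1 := by
  by_cases h : ‖z‖ < 1
  · rw [extendZero_mk _ h]
    exact (φ _).norm_lt_one
  · simp [extendZero, h]

lemma extendZero_comp (f : 𝔻 → ℂ) (φ : 𝔻 → 𝔻) {z : ℂ} (hz : ‖z‖ < 1) :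
    extendZero (f ∘ φ) z = extendZero f (extendZero (fun z => (φ z : ℂ)) z) := by
  rw [extendZero_mk _ hz, extendZero_mk _ hz, extendZero_coe]
  rfl

lemma IsHolo.comp {f : 𝔻 → ℂ} {φ : 𝔻 → 𝔻} (hf : IsHolo f) (hφ : IsHolo fun z => (φ z : ℂ)) :
    IsHolo (f ∘ φ) := by
  refine (DifferentiableOn.comp hf hφ fun z _ => ?_).congr fun z hz =>
    extendZero_comp f φ (by simpa using hz)
  simpa using norm_extendZero_selfMap_lt_one φ z

lemma derivDisc_comp {f : 𝔻 → ℂ} {φ : 𝔻 → 𝔻} (hf : IsHolo f) (hφ : IsHolo fun z => (φ z : ℂ))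
    {z : ℂ} (hz : z ∈ Metric.ball (0 : ℂ) 1) :
    derivDisc (f ∘ φ) z =
      derivDisc f (extendZero (fun z => (φ z : ℂ)) z) * derivDisc (fun z => (φ z : ℂ)) z := by
  have h : extendZero (f ∘ φ) =ᶠ[𝓝 z] extendZero f ∘ extendZero (fun z => (φ z : ℂ)) := by
    filter_upwards [Metric.isOpen_ball.mem_nhds hz] with w hw
    exact extendZero_comp f φ (by simpa using hw)
  rw [derivDisc, h.deriv_eq, deriv_comp]
  · rfl
  · exact hf.differentiableAt (by simpa using norm_extendZero_selfMap_lt_one φ z)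
  · exact hφ.differentiableAt hz

lemma IsHolo.measurable_extendZero {f : 𝔻 → ℂ} (hf : IsHolo f) : Measurable (extendZero f) := by
  classical
  have h := ContinuousOn.measurable_piecewise (s := Metric.ball (0 : ℂ) 1) (f := extendZero f)
    (g := fun _ => (0 : ℂ)) (DifferentiableOn.continuousOn hf) continuousOn_const
    Metric.isOpen_ball.measurableSet
  convert h using 1
  funext z
  by_cases hz : ‖z‖ < 1
  · simp [Set.piecewise, hz]
  · simp [Set.piecewise, extendZero, hz]

/-- The image under `φ` of the measure `|φ'|^p dA_α`. -/
def imageMeasure (p α : ℝ) (φ : 𝔻 → 𝔻) : Measure ℂ :=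
  ((weightedArea α).withDensity fun z => ‖derivDisc (fun z => (φ z : ℂ)) z‖ₑ ^ p).map
    (extendZero fun z => (φ z : ℂ))

/-- The total mass is `∫ |φ'|^p dA_α`, so this is where `φ ∈ 𝓓^p_α` enters. -/
lemma isFiniteMeasure_imageMeasure {p α : ℝ} (hp : 1 ≤ p) {φ : 𝔻 → 𝔻}
    (hφ : MemDirichlet p α fun z => (φ z : ℂ)) : IsFiniteMeasure (imageMeasure p α φ) := by
  have h : IsFiniteMeasure ((weightedArea α).withDensity
      fun z => ‖derivDisc (fun z => (φ z : ℂ)) z‖ₑ ^ p) := by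
    refine isFiniteMeasure_withDensity ?_
    exact ((lintegral_derivDisc_le hp α _).trans_lt
      (ENNReal.rpow_lt_top_of_nonneg (by linarith) hφ.2.ne)).ne
  unfold imageMeasure
  infer_instance

lemma ae_imageMeasure_norm_lt_one {p α : ℝ} {φ : 𝔻 → 𝔻} (hφ : IsHolo fun z => (φ z : ℂ)) :
    ∀ᵐ z ∂(imageMeasure p α φ), ‖z‖ < 1 := by
  rw [imageMeasure, ae_map_iff hφ.measurable_extendZero.aemeasurable
    (measurableSet_lt measurable_norm measurable_const)]
  exact Eventually.of_forall fun z => norm_extendZero_selfMap_lt_one φ z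

lemma lintegral_derivDisc_comp {p α : ℝ} (hp : 1 ≤ p) {f : 𝔻 → ℂ} {φ : 𝔻 → 𝔻} (hf : IsHolo f)
    (hφ : IsHolo fun z => (φ z : ℂ)) :
    ∫⁻ z, ‖derivDisc (f ∘ φ) z‖ₑ ^ p ∂(weightedArea α) =
      ∫⁻ z, ‖derivDisc f z‖ₑ ^ p ∂(imageMeasure p α φ) := by
  have hm := measurable_derivDisc f
  have hm' := measurable_derivDisc fun z => (φ z : ℂ)
  have hφm := hφ.measurable_extendZero
  rw [imageMeasure, lintegral_map (by fun_prop) hφm,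
    lintegral_withDensity_eq_lintegral_mul _ (by fun_prop) (by fun_prop)]
  refine lintegral_congr_ae ?_
  filter_upwards [weightedArea_ae_mem α] with z hz
  rw [derivDisc_comp hf hφ hz, enorm_mul, ENNReal.mul_rpow_of_nonneg _ _ (by linarith), mul_comm]
  rfl

lemma dirichletENorm_comp_rpow {p α : ℝ} (hp : 1 ≤ p) {f : 𝔻 → ℂ} {φ : 𝔻 → 𝔻} (hf : IsHolo f)
    (hφ : IsHolo fun z => (φ z : ℂ)) :
    dirichletENorm p α (f ∘ φ) ^ p =
      ‖f (φ 0)‖ₑ ^ p + ∫⁻ z, ‖derivDisc f z‖ₑ ^ p ∂(imageMeasure p α φ) := by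
  rw [dirichletENorm_rpow hp, lintegral_derivDisc_comp hp hf hφ]
  rfl

/-! ### The test functions -/

lemma hasDerivAt_extendZero_testFun (l : 𝔻) (β : ℝ) {z : ℂ} (hz : ‖z‖ < 1) :
    HasDerivAt (extendZero (testFun l β))
      (((1 + β : ℝ) : ℂ) * conj (l : ℂ) * (1 - conj (l : ℂ) * z) ^ ((-(2 + β) : ℝ) : ℂ)) z := by
  have hev : extendZero (testFun l β) =ᶠ[𝓝 z]
      fun w => (1 - conj (l : ℂ) * w) ^ (-((1 + β : ℝ) : ℂ)) := by
    filter_upwards [Metric.isOpen_ball.mem_nhds (show z ∈ Metric.ball (0 : ℂ) 1 by simpa using hz)]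
      with w hw
    rw [extendZero_mk _ (by simpa using hw), testFun, Complex.cpow_neg, one_div]
    rfl
  have hslit : 1 - conj (l : ℂ) * z ∈ Complex.slitPlane := by
    rw [sub_eq_add_neg]
    refine Complex.mem_slitPlane_of_norm_lt_one ?_
    rw [norm_neg, norm_mul, RCLike.norm_conj]
    nlinarith [norm_nonneg z, l.norm_lt_one, norm_nonneg (l : ℂ)]
  refine HasDerivAt.congr_of_eventuallyEq ?_ hev
  have h1 : HasDerivAt (fun w : ℂ => 1 - conj (l : ℂ) * w) (-(conj (l : ℂ))) z := by
    simpa using ((hasDerivAt_id z).const_mul (conj (l : ℂ))).const_sub 1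
  refine (h1.cpow_const (c := -((1 + β : ℝ) : ℂ)) hslit).congr_deriv ?_
  rw [show -((1 + β : ℝ) : ℂ) - 1 = ((-(2 + β) : ℝ) : ℂ) by push_cast; ring]
  ring

lemma isHolo_testFun (l : 𝔻) (β : ℝ) : IsHolo (testFun l β) := fun z hz =>
  (hasDerivAt_extendZero_testFun l β (by simpa using hz)).differentiableAt.differentiableWithinAt

lemma enorm_derivDisc_testFun_rpow {p β : ℝ} (hp : 1 ≤ p) (hβ : 0 ≤ β) (l : 𝔻) {z : ℂ}
    (hz : ‖z‖ < 1) :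
    ‖derivDisc (testFun l β) z‖ₑ ^ p = ENNReal.ofReal (((1 + β) * ‖(l : ℂ)‖) ^ p) *
      ENNReal.ofReal (‖1 - conj (l : ℂ) * z‖ ^ (-((2 + β) * p))) := by
  rw [derivDisc, (hasDerivAt_extendZero_testFun l β hz).deriv, ← ofReal_norm,
    ENNReal.ofReal_rpow_of_nonneg (norm_nonneg _) (by linarith), norm_mul, norm_mul,
    Complex.norm_cpow_real, RCLike.norm_conj, Complex.norm_real, Real.norm_of_nonneg (by linarith),
    Real.mul_rpow (by positivity) (by positivity), ENNReal.ofReal_mul (by positivity),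
    ← Real.rpow_mul (norm_nonneg _), neg_mul]

lemma ofReal_rpow_delta_rpow {p α β : ℝ} (hp : 1 ≤ p) (l : 𝔻) :
    ENNReal.ofReal ((1 - ‖(l : ℂ)‖ ^ 2) ^ (2 + β - (2 + α) / p)) ^ p =
      ENNReal.ofReal ((1 - ‖(l : ℂ)‖ ^ 2) ^ ((2 + β) * p - (2 + α))) := by
  have hX : 0 < 1 - ‖(l : ℂ)‖ ^ 2 := by linarith [l.sq_norm_lt_one]
  rw [ENNReal.ofReal_rpow_of_nonneg (by positivity) (by linarith), ← Real.rpow_mul hX.le]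
  congr 2
  field_simp

/-- The derivative of the test function carries a factor `conj l` that degenerates at `0`; keeping
`‖l‖ ≥ 1/2` costs `2 ^ p`. The term at `φ 0` is dropped. -/
lemma kernel_le_testQuantity_rpow {p α β : ℝ} (hp : 1 ≤ p) (hβ : 0 ≤ β) {φ : 𝔻 → 𝔻}
    (hφ : IsHolo fun z => (φ z : ℂ)) {l : 𝔻} (hl : 1 / 2 ≤ ‖(l : ℂ)‖) :
    ENNReal.ofReal ((1 - ‖(l : ℂ)‖ ^ 2) ^ ((2 + β) * p - (2 + α))) *
      ∫⁻ z, ENNReal.ofReal (‖1 - conj (l : ℂ) * z‖ ^ (-((2 + β) * p))) ∂(imageMeasure p α φ) ≤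
    ENNReal.ofReal (2 ^ p) * testQuantity p α β φ l ^ p := by
  have h1 : ∫⁻ z, ‖derivDisc (testFun l β) z‖ₑ ^ p ∂(imageMeasure p α φ) =
      ENNReal.ofReal (((1 + β) * ‖(l : ℂ)‖) ^ p) *
        ∫⁻ z, ENNReal.ofReal (‖1 - conj (l : ℂ) * z‖ ^ (-((2 + β) * p))) ∂(imageMeasure p α φ) := by
    rw [← lintegral_const_mul _ (by fun_prop)]
    refine lintegral_congr_ae ?_
    filter_upwards [ae_imageMeasure_norm_lt_one hφ] with z hz
    exact enorm_derivDisc_testFun_rpow hp hβ l hz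
  rw [testQuantity, ENNReal.mul_rpow_of_nonneg _ _ (by linarith), ofReal_rpow_delta_rpow hp,
    dirichletENorm_comp_rpow hp (isHolo_testFun l β) hφ, h1]
  set I := ∫⁻ z, ENNReal.ofReal (‖1 - conj (l : ℂ) * z‖ ^ (-((2 + β) * p))) ∂(imageMeasure p α φ)
  set X := ENNReal.ofReal ((1 - ‖(l : ℂ)‖ ^ 2) ^ ((2 + β) * p - (2 + α)))
  calc X * I = X * (1 * I) := by rw [one_mul]
    _ ≤ X * (ENNReal.ofReal (2 ^ p) * ENNReal.ofReal (((1 + β) * ‖(l : ℂ)‖) ^ p) * I) := by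
        gcongr
        rw [← ENNReal.ofReal_mul (by positivity), ← Real.mul_rpow (by positivity) (by positivity),
          ENNReal.one_le_ofReal]
        exact Real.one_le_rpow (by nlinarith) (by linarith)
    _ = ENNReal.ofReal (2 ^ p) * (X * (ENNReal.ofReal (((1 + β) * ‖(l : ℂ)‖) ^ p) * I)) := by ring
    _ ≤ _ := by
        gcongr
        exact le_add_self

lemma exists_dirichletENorm_testFun_le {p α β : ℝ} (hp : 1 ≤ p) (hα : -1 < α) (hβ : 0 ≤ β)
    (hδ : 0 < 2 + β - (2 + α) / p) :
    ∃ C : ℝ≥0∞, C ≠ ∞ ∧ ∀ l : 𝔻,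
      ENNReal.ofReal ((1 - ‖(l : ℂ)‖ ^ 2) ^ (2 + β - (2 + α) / p)) *
        dirichletENorm p α (testFun l β) ≤ C := by
  have hp0 : 0 < p := by linarith
  -- This is `p δ`, and `2 + α + s = (2 + β) p` is the exponent in the Forelli–Rudin integral.
  set s := (2 + β) * p - (2 + α) with hs
  have hs0 : 0 < s := by
    have : s = (2 + β - (2 + α) / p) * p := by rw [hs]; field_simp
    rw [this]; positivity
  obtain ⟨C, hC0, hC⟩ := exists_forelliRudin hα hs0
  refine ⟨(1 + ENNReal.ofReal ((1 + β) ^ p) * ENNReal.ofReal (2 ^ s * C)) ^ (1 / p),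
    ENNReal.rpow_ne_top_of_nonneg (by positivity) (by finiteness), fun l => ?_⟩
  have hX : 0 < 1 - ‖(l : ℂ)‖ ^ 2 := by linarith [l.sq_norm_lt_one]
  have hx : 0 < 1 - ‖(l : ℂ)‖ := by linarith [l.norm_lt_one]
  rw [one_div, ENNReal.le_rpow_inv_iff hp0, ENNReal.mul_rpow_of_nonneg _ _ hp0.le,
    ofReal_rpow_delta_rpow hp, dirichletENorm_rpow hp]
  have h0 : ‖testFun l β 0‖ₑ = 1 := by simp [testFun]
  have hI : ∫⁻ z, ‖derivDisc (testFun l β) z‖ₑ ^ p ∂(weightedArea α) ≤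
      ENNReal.ofReal ((1 + β) ^ p) * ENNReal.ofReal (C * (1 - ‖(l : ℂ)‖) ^ (-s)) := by
    have h1 : ∫⁻ z, ‖derivDisc (testFun l β) z‖ₑ ^ p ∂(weightedArea α) =
        ENNReal.ofReal (((1 + β) * ‖(l : ℂ)‖) ^ p) *
          ∫⁻ z, ENNReal.ofReal (‖1 - conj (l : ℂ) * z‖ ^ (-(2 + α + s))) ∂(weightedArea α) := by
      rw [← lintegral_const_mul _ (by fun_prop)]
      refine lintegral_congr_ae ?_
      filter_upwards [weightedArea_ae_mem α] with z hz
      rw [enorm_derivDisc_testFun_rpow hp hβ l (by simpa using hz),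
        show 2 + α + s = (2 + β) * p by rw [hs]; ring]
    rw [h1]
    gcongr
    · exact mul_le_of_le_one_right (by linarith) l.norm_lt_one.le
    · exact hC l l.norm_lt_one
  rw [h0, ENNReal.one_rpow, mul_add, mul_one]
  refine add_le_add ?_ ?_
  · rw [ENNReal.ofReal_le_one]
    exact Real.rpow_le_one hX.le (by nlinarith [norm_nonneg (l : ℂ)]) hs0.le
  · refine (mul_le_mul_right hI _).trans ?_
    rw [mul_left_comm]
    gcongr
    rw [← ENNReal.ofReal_mul (by positivity)]
    refine ENNReal.ofReal_le_ofReal ?_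
    have h2 : (1 - ‖(l : ℂ)‖ ^ 2) ^ s ≤ 2 ^ s * (1 - ‖(l : ℂ)‖) ^ s := by
      have := one_sub_sq_rpow_le (α := s) (norm_nonneg (l : ℂ)) l.norm_lt_one
      rwa [abs_of_pos hs0] at this
    calc (1 - ‖(l : ℂ)‖ ^ 2) ^ s * (C * (1 - ‖(l : ℂ)‖) ^ (-s))
        ≤ 2 ^ s * (1 - ‖(l : ℂ)‖) ^ s * (C * (1 - ‖(l : ℂ)‖) ^ (-s)) := by gcongr
      _ = 2 ^ s * C * ((1 - ‖(l : ℂ)‖) ^ s * (1 - ‖(l : ℂ)‖) ^ (-s)) := by ring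
      _ = 2 ^ s * C := by rw [← Real.rpow_add hx, add_neg_cancel, Real.rpow_zero, mul_one]

/-! ### Montel's theorem on the disc -/

lemma tendstoUniformlyOn_tsum_mul_pow {a : ℕ → ℕ → ℂ} {b : ℕ → ℂ} {r : ℝ} (hr : 0 ≤ r)
    {u : ℕ → ℝ} (hu : Summable u) (hau : ∀ n k, ‖a n k‖ * r ^ k ≤ u k)
    (hab : ∀ k, Tendsto (fun n => a n k) atTop (𝓝 (b k))) :
    TendstoUniformlyOn (fun n z => ∑' k, a n k * z ^ k) (fun z => ∑' k, b k * z ^ k) atTop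
      (Metric.ball 0 r) := by
  have hbu : ∀ k, ‖b k‖ * r ^ k ≤ u k := fun k =>
    le_of_tendsto ((hab k).norm.mul_const _) (Eventually.of_forall fun n => hau n k)
  have hlim : Tendsto (fun n => ∑' k, ‖b k - a n k‖ * r ^ k) atTop (𝓝 0) := by
    have := tendsto_tsum_of_dominated_convergence (𝓕 := atTop) (g := fun _ : ℕ => (0 : ℝ))
      (f := fun n k => ‖b k - a n k‖ * r ^ k) (bound := fun k => 2 * u k) (hu.mul_left 2)
      (fun k => by
        have h := ((tendsto_const_nhds (x := b k)).sub (hab k)).norm.mul_const (r ^ k)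
        simpa using h)
      (Eventually.of_forall fun n k => by
        rw [Real.norm_of_nonneg (by positivity)]
        calc ‖b k - a n k‖ * r ^ k ≤ (‖b k‖ + ‖a n k‖) * r ^ k := by gcongr; exact norm_sub_le _ _
          _ ≤ 2 * u k := by linarith [hbu k, hau n k])
    simpa using this
  rw [Metric.tendstoUniformlyOn_iff]
  intro ε hε
  filter_upwards [(tendsto_order.1 hlim).2 ε hε] with n hn z hz
  have hz' : ‖z‖ ≤ r := by
    rw [mem_ball_zero_iff] at hz; exact hz.le
  have hsum : ∀ c : ℕ → ℂ, (∀ k, ‖c k‖ * r ^ k ≤ u k) → Summable fun k => c k * z ^ k := by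
    intro c hc
    refine Summable.of_norm_bounded hu fun k => ?_
    rw [norm_mul, norm_pow]
    exact (by gcongr : ‖c k‖ * ‖z‖ ^ k ≤ ‖c k‖ * r ^ k).trans (hc k)
  have hsum' : Summable fun k => ‖b k - a n k‖ * r ^ k := by
    refine Summable.of_norm_bounded (hu.mul_left 2) fun k => ?_
    rw [Real.norm_of_nonneg (by positivity)]
    calc ‖b k - a n k‖ * r ^ k ≤ (‖b k‖ + ‖a n k‖) * r ^ k := by gcongr; exact norm_sub_le _ _
      _ ≤ 2 * u k := by linarith [hbu k, hau n k]
  rw [dist_eq_norm, ← (hsum b hbu).tsum_sub (hsum (a n) (hau n))]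
  refine (tsum_of_norm_bounded hsum'.hasSum fun k => ?_).trans_lt hn
  rw [← sub_mul, norm_mul, norm_pow]
  gcongr

/-- Montel through Taylor coefficients: Cauchy's estimates put the coefficient sequences in a
compact product of discs, so a subsequence converges coefficientwise. Cauchy's estimates on a larger
circle `R > r` give the geometric majorant `N (r / R) ^ k`, hence uniform convergence on the ball of
radius `r`. -/
lemma exists_subseq_tendstoLocallyUniformlyOn {F : ℕ → ℂ → ℂ}
    (hF : ∀ n, DifferentiableOn ℂ (F n) (Metric.ball 0 1))
    (hb : ∀ R : ℝ, 0 ≤ R → R < 1 → ∃ M : ℝ, ∀ n z, ‖z‖ ≤ R → ‖F n z‖ ≤ M) :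
    ∃ (G : ℂ → ℂ) (ψ : ℕ → ℕ), StrictMono ψ ∧
      TendstoLocallyUniformlyOn (fun n => F (ψ n)) G atTop (Metric.ball 0 1) := by
  set a : ℕ → ℕ → ℂ := fun n k => (k.factorial : ℂ)⁻¹ * iteratedDeriv k (F n) 0 with ha
  have hcoef : ∀ R : ℝ, 0 < R → R < 1 → ∃ M : ℝ, ∀ n k, ‖a n k‖ ≤ M / R ^ k := by
    intro R hR0 hR1
    obtain ⟨M, hM⟩ := hb R hR0.le hR1
    refine ⟨M, fun n k => ?_⟩
    have hd : DiffContOnCl ℂ (F n) (Metric.ball 0 R) :=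
      ((hF n).mono (by
        rw [closure_ball _ hR0.ne']
        exact Metric.closedBall_subset_ball hR1)).diffContOnCl
    have h := Complex.norm_iteratedDeriv_le_of_forall_mem_sphere_norm_le k hR0 hd
      fun z hz => hM n z (by simpa using (mem_sphere_zero_iff_norm.1 hz).le)
    rw [ha, norm_mul, norm_inv, Complex.norm_natCast, inv_mul_le_iff₀ (by positivity)]
    rwa [← mul_div_assoc]
  have hser : ∀ n, ∀ z ∈ Metric.ball (0 : ℂ) 1, ∑' k, a n k * z ^ k = F n z := by
    intro n z hz
    rw [← (Complex.hasSum_taylorSeries_on_ball (hF n) hz).tsum_eq]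
    refine tsum_congr fun k => ?_
    simp only [ha, sub_zero, smul_eq_mul]
    ring
  obtain ⟨M, hM⟩ := hcoef (1 / 2) (by norm_num) (by norm_num)
  have hK : IsCompact (Set.univ.pi fun k : ℕ => Metric.closedBall (0 : ℂ) (M / (1 / 2) ^ k)) :=
    isCompact_univ_pi fun k => isCompact_closedBall _ _
  obtain ⟨b, -, ψ, hψ, hlim⟩ := hK.tendsto_subseq (x := a) fun n k _ => by simpa using hM n k
  rw [tendsto_pi_nhds] at hlim
  refine ⟨fun z => ∑' k, b k * z ^ k, ψ, hψ, fun u hu z hz => ?_⟩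
  obtain ⟨r, hzr, hr1⟩ := exists_between (mem_ball_zero_iff.1 hz)
  obtain ⟨R, hrR, hR1⟩ := exists_between hr1
  have hr0 : 0 ≤ r := (norm_nonneg z).trans hzr.le
  have hR0 : 0 < R := hr0.trans_lt hrR
  obtain ⟨N, hN⟩ := hcoef R hR0 hR1
  have hsum : Summable fun k : ℕ => N * (r / R) ^ k :=
    (summable_geometric_of_lt_one (by positivity) ((div_lt_one hR0).2 hrR)).mul_left N
  have hunif := tendstoUniformlyOn_tsum_mul_pow (a := fun n => a (ψ n)) hr0 hsum
    (fun n k => by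
      calc ‖a (ψ n) k‖ * r ^ k ≤ N / R ^ k * r ^ k := by gcongr; exact hN _ _
        _ = N * (r / R) ^ k := by rw [div_pow]; ring) hlim
  refine ⟨Metric.ball 0 r, mem_nhdsWithin_of_mem_nhds
    (Metric.isOpen_ball.mem_nhds (by simpa using hzr)), ?_⟩
  filter_upwards [hunif u hu] with n hn w hw
  have := hn w hw
  rwa [hser _ w (Metric.ball_subset_ball hr1.le hw)] at this

lemma tendsto_enorm_rpow {u : ℕ → ℂ} {a : ℂ} (h : Tendsto u atTop (𝓝 a)) (p : ℝ) :
    Tendsto (fun n => ‖u n‖ₑ ^ p) atTop (𝓝 (‖a‖ₑ ^ p)) :=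
  (ENNReal.continuous_rpow_const.tendsto _).comp ((continuous_enorm.tendsto a).comp h)

lemma exists_subseq_tendsto_of_dirichletENorm_le {p α : ℝ} (hp : 1 ≤ p) (hα : -1 < α)
    {f : ℕ → 𝔻 → ℂ} (hf : ∀ n, IsHolo (f n)) {B : ℝ≥0∞} (hB : B ≠ ∞)
    (hfB : ∀ n, dirichletENorm p α (f n) ≤ B) :
    ∃ (g : 𝔻 → ℂ) (ψ : ℕ → ℕ), StrictMono ψ ∧ IsHolo g ∧ dirichletENorm p α g ≤ B ∧
      (∀ z, Tendsto (fun n => f (ψ n) z) atTop (𝓝 (g z))) ∧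
      ∀ z ∈ Metric.ball (0 : ℂ) 1,
        Tendsto (fun n => derivDisc (f (ψ n)) z) atTop (𝓝 (derivDisc g z)) := by
  have hp0 : 0 < p := by linarith
  obtain ⟨G, ψ, hψ, hG⟩ := exists_subseq_tendstoLocallyUniformlyOn (F := fun n => extendZero (f n))
    hf fun R hR0 hR1 => by
      obtain ⟨C, hC, h⟩ := exists_enorm_le_dirichletENorm hp hα hR0 hR1
      refine ⟨(C * B).toReal, fun n z hz => ?_⟩
      rw [← ENNReal.ofReal_le_iff_le_toReal (ENNReal.mul_ne_top hC hB), ofReal_norm]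
      exact ((h (f n) ⟨hf n, (hfB n).trans_lt hB.lt_top⟩ z hz).2).trans (by gcongr; exact hfB n)
  have hGd : DifferentiableOn ℂ G (Metric.ball 0 1) :=
    hG.differentiableOn (Eventually.of_forall fun n => hf (ψ n)) Metric.isOpen_ball
  have heq : Set.EqOn (extendZero fun z : 𝔻 => G z) G (Metric.ball 0 1) := fun z hz => by
    rw [extendZero_mk _ (by simpa using hz)]
    rfl
  have hg : IsHolo fun z : 𝔻 => G z := hGd.congr heq
  have hpt : ∀ z : 𝔻, Tendsto (fun n => f (ψ n) z) atTop (𝓝 (G z)) := by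
    intro z
    have := hG.tendsto_at (a := (z : ℂ)) (by simpa using z.norm_lt_one)
    simpa only [extendZero_coe] using this
  have hder : ∀ z ∈ Metric.ball (0 : ℂ) 1, Tendsto (fun n => derivDisc (f (ψ n)) z) atTop
      (𝓝 (derivDisc (fun z : 𝔻 => G z) z)) := by
    intro z hz
    have h1 := (hG.deriv (Eventually.of_forall fun n => hf (ψ n)) Metric.isOpen_ball).tendsto_at hz
    have h2 : derivDisc (fun z : 𝔻 => G z) z = deriv G z :=
      (heq.eventuallyEq_of_mem (Metric.isOpen_ball.mem_nhds hz)).deriv_eq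
    rw [h2]
    exact h1
  refine ⟨fun z => G z, ψ, hψ, hg, ?_, hpt, hder⟩
  rw [← ENNReal.rpow_le_rpow_iff hp0, dirichletENorm_rpow hp]
  have hle : ∀ n, ‖f (ψ n) 0‖ₑ ^ p + ∫⁻ z, ‖derivDisc (f (ψ n)) z‖ₑ ^ p ∂(weightedArea α) ≤
      B ^ p := fun n => by
    rw [← dirichletENorm_rpow hp]
    exact ENNReal.rpow_le_rpow (hfB _) hp0.le
  have hfatou : ∫⁻ z, ‖derivDisc (fun z : 𝔻 => G z) z‖ₑ ^ p ∂(weightedArea α) ≤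
      liminf (fun n => ∫⁻ z, ‖derivDisc (f (ψ n)) z‖ₑ ^ p ∂(weightedArea α)) atTop := by
    refine le_trans (le_of_eq (lintegral_congr_ae ?_)) (lintegral_liminf_le fun n => ?_)
    · filter_upwards [weightedArea_ae_mem α] with z hz
      exact (tendsto_enorm_rpow (hder z hz) p).liminf_eq.symm
    · exact (measurable_derivDisc _).enorm.pow_const p
  have hfin : ∀ n, ‖f (ψ n) 0‖ₑ ^ p ≠ ∞ := fun n => by finiteness
  have h0 := tendsto_enorm_rpow (hpt 0) p
  have h0B : ‖G (0 : 𝔻)‖ₑ ^ p ≤ B ^ p :=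
    le_of_tendsto h0 (Eventually.of_forall fun n => le_self_add.trans (hle n))
  -- The bound is on the sum of the two terms, so the convergent value at `0` is subtracted from `B
  -- ^ p` before Fatou is used for the integral.
  have hsub : Tendsto (fun n => B ^ p - ‖f (ψ n) 0‖ₑ ^ p) atTop (𝓝 (B ^ p - ‖G (0 : 𝔻)‖ₑ ^ p)) :=
    ENNReal.Tendsto.sub tendsto_const_nhds h0 (Or.inr (by finiteness))
  have hint : ∫⁻ z, ‖derivDisc (fun z : 𝔻 => G z) z‖ₑ ^ p ∂(weightedArea α) ≤
      B ^ p - ‖G (0 : 𝔻)‖ₑ ^ p := by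
    refine hfatou.trans ((liminf_le_liminf (Eventually.of_forall fun n => ?_)).trans
      hsub.liminf_eq.le)
    exact ENNReal.le_sub_of_add_le_left (hfin n) (hle n)
  exact (add_le_add le_rfl hint).trans (add_tsub_cancel_of_le h0B).le

/-! ### Boundedness -/

/-- The radius `R = 1 - 2/3 (1 - ρ)` solves `ρ = 1 - 3/2 (1 - R)` in `exists_carleson`. That `C`
precedes `ρ` and `M` lets `M` be taken small in the compactness proof. -/
lemma exists_lintegral_annulus_le {p α β : ℝ} (hp : 1 ≤ p) (hα : -1 < α) (hβ : 0 ≤ β)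
    {φ : 𝔻 → 𝔻} (hφ : MemDirichlet p α fun z => (φ z : ℂ)) :
    ∃ C : ℝ≥0∞, C ≠ ∞ ∧ ∀ (ρ : ℝ) (M : ℝ≥0∞), 1 / 2 ≤ ρ →
      (∀ l : 𝔻, ρ ≤ ‖(l : ℂ)‖ → testQuantity p α β φ l ≤ M) → ∀ f : 𝔻 → ℂ, IsHolo f →
      ∫⁻ z in {z | 1 - 2 / 3 * (1 - ρ) ≤ ‖z‖ ∧ ‖z‖ < 1}, ‖derivDisc f z‖ₑ ^ p
        ∂(imageMeasure p α φ) ≤ C * M ^ p * dirichletENorm p α f ^ p := by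
  have hp0 : 0 < p := by linarith
  have := isFiniteMeasure_imageMeasure hp hφ
  obtain ⟨C, hC, h⟩ := exists_carleson (q := (2 + β) * p) hp hα (by positivity)
  refine ⟨C * ENNReal.ofReal (2 ^ p), by finiteness, fun ρ M hρ hM f hf => ?_⟩
  refine (h (imageMeasure p α φ) ρ _ (ENNReal.ofReal (2 ^ p) * M ^ p) (by linarith)
    (fun w hw hw1 => ?_) (derivDisc f) (measurable_derivDisc f)
    hf.differentiableOn_derivDisc).trans ?_
  · refine (kernel_le_testQuantity_rpow (l := Complex.UnitDisc.mk w hw1) hp hβ hφ.1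
      (hρ.trans hw)).trans ?_
    gcongr
    exact hM _ hw
  · rw [← mul_assoc]
    gcongr
    exact lintegral_derivDisc_le hp α f

lemma lintegral_imageMeasure_le_annulus_add {p α : ℝ} {φ : 𝔻 → 𝔻}
    (hφ : IsHolo fun z => (φ z : ℂ)) (R : ℝ) (h : ℂ → ℝ≥0∞) :
    ∫⁻ z, h z ∂(imageMeasure p α φ) ≤
      ∫⁻ z in {z | R ≤ ‖z‖ ∧ ‖z‖ < 1}, h z ∂(imageMeasure p α φ) +
        ∫⁻ z in Metric.closedBall 0 R, h z ∂(imageMeasure p α φ) := by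
  refine le_trans (le_of_eq ?_) (lintegral_union_le _ _ _)
  rw [Measure.restrict_eq_self_of_ae_mem]
  filter_upwards [ae_imageMeasure_norm_lt_one hφ] with z hz
  rcases le_total R ‖z‖ with hR | hR
  · exact Or.inl ⟨hR, hz⟩
  · exact Or.inr (by simpa using hR)

/-- Control of the test quantity near the circle is enough, because `ν` is finite and `f'` is
bounded by the norm on the complementary compact disc. This also covers (b), where only the
behaviour as `|λ| → 1` is given. -/
lemma exists_dirichletENorm_comp_le {p α β : ℝ} (hp : 1 ≤ p) (hα : -1 < α) (hβ : 0 ≤ β)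
    {φ : 𝔻 → 𝔻} (hφ : MemDirichlet p α fun z => (φ z : ℂ)) {ρ : ℝ} (hρ : ρ < 1) {M : ℝ≥0∞}
    (hM : M ≠ ∞) (h : ∀ l : 𝔻, ρ ≤ ‖(l : ℂ)‖ → testQuantity p α β φ l ≤ M) :
    ∃ C : ℝ≥0∞, C ≠ ∞ ∧ ∀ f : 𝔻 → ℂ, MemDirichlet p α f →
      dirichletENorm p α (f ∘ φ) ≤ C * dirichletENorm p α f := by
  have hp0 : 0 < p := by linarith
  have := isFiniteMeasure_imageMeasure hp hφ
  set ρ' := max ρ (1 / 2) with hρ'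
  have hρ1 : ρ' < 1 := max_lt hρ (by norm_num)
  have hρ2 : 1 / 2 ≤ ρ' := le_max_right _ _
  set R := 1 - 2 / 3 * (1 - ρ') with hR
  obtain ⟨C₁, hC₁, h₁⟩ := exists_lintegral_annulus_le hp hα hβ hφ
  obtain ⟨C₂, hC₂, h₂⟩ := exists_enorm_le_dirichletENorm (p := p) (R := R) hp hα
    (by rw [hR]; linarith) (by rw [hR]; linarith)
  obtain ⟨C₃, hC₃, h₃⟩ := exists_enorm_le_dirichletENorm (p := p) hp hα
    (norm_nonneg (φ 0 : ℂ)) (φ 0).norm_lt_one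
  have hMp : M ^ p ≠ ∞ := ENNReal.rpow_ne_top_of_nonneg hp0.le hM
  have hC₂p : C₂ ^ p ≠ ∞ := ENNReal.rpow_ne_top_of_nonneg hp0.le hC₂
  have hC₃p : C₃ ^ p ≠ ∞ := ENNReal.rpow_ne_top_of_nonneg hp0.le hC₃
  set ν := imageMeasure p α φ with hν
  refine ⟨(C₃ ^ p + (C₁ * M ^ p + C₂ ^ p * ν Set.univ)) ^ p⁻¹,
    ENNReal.rpow_ne_top_of_nonneg (by positivity) (by finiteness), fun f hf => ?_⟩
  set N := dirichletENorm p α f with hN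
  have hin : ∫⁻ z in Metric.closedBall 0 R, ‖derivDisc f z‖ₑ ^ p ∂ν ≤
      C₂ ^ p * ν Set.univ * N ^ p := by
    calc _ ≤ ∫⁻ _ in Metric.closedBall (0 : ℂ) R, (C₂ * N) ^ p ∂ν := by
          refine setLIntegral_mono' Metric.isClosed_closedBall.measurableSet fun z hz => ?_
          exact ENNReal.rpow_le_rpow (h₂ f hf z (by simpa using hz)).1 hp0.le
      _ ≤ ∫⁻ _, (C₂ * N) ^ p ∂ν := setLIntegral_le_lintegral _ _
      _ = _ := by
          rw [lintegral_const, ENNReal.mul_rpow_of_nonneg _ _ hp0.le]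
          ring
  have hout := h₁ ρ' M hρ2 (fun l hl => h l ((le_max_left _ _).trans hl)) f hf.1
  have hpt : ‖f (φ 0)‖ₑ ≤ C₃ * N := by
    have := (h₃ f hf (φ 0) le_rfl).2
    rwa [extendZero_coe] at this
  rw [← ENNReal.rpow_le_rpow_iff hp0, dirichletENorm_comp_rpow hp hf.1 hφ.1,
    ENNReal.mul_rpow_of_nonneg _ _ hp0.le, ENNReal.rpow_inv_rpow hp0.ne', add_mul, add_mul]
  refine add_le_add ?_ ?_
  · rw [← ENNReal.mul_rpow_of_nonneg _ _ hp0.le]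
    exact ENNReal.rpow_le_rpow hpt hp0.le
  · exact (lintegral_imageMeasure_le_annulus_add hφ.1 R _).trans (add_le_add hout hin)

/-- An element of `𝓓^p_α` given by a function and its membership. -/
def toDirichletSpace {p α : ℝ} [Fact (1 ≤ p)] (f : 𝔻 → ℂ) (hf : MemDirichlet p α f) :
    DirichletSpace p α := ⟨f, hf⟩

lemma coe_toDirichletSpace {p α : ℝ} [Fact (1 ≤ p)] (f : 𝔻 → ℂ) (hf : MemDirichlet p α f) :
    (toDirichletSpace f hf : 𝔻 → ℂ) = f := rfl

/-! ### From norm inequalities to operators on `DirichletSpace` -/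

section Operators

variable {p α β : ℝ} [hp : Fact (1 ≤ p)] [hα : Fact (-1 < α)]

lemma enorm_dirichletSpace (f : DirichletSpace p α) : ‖f‖ₑ = dirichletENorm p α f := by
  rw [← ofReal_norm]
  exact ENNReal.ofReal_toReal f.2.2.ne

lemma exists_compositionOperator {φ : 𝔻 → 𝔻} (hφ : IsHolo fun z => (φ z : ℂ)) {C : ℝ≥0∞}
    (hC : C ≠ ∞) (h : ∀ f : 𝔻 → ℂ, MemDirichlet p α f →
      dirichletENorm p α (f ∘ φ) ≤ C * dirichletENorm p α f) :
    ∃ T : DirichletSpace p α →L[ℂ] DirichletSpace p α,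
      ∀ f, (T f : 𝔻 → ℂ) = (f : 𝔻 → ℂ) ∘ φ := by
  let L : DirichletSpace p α →ₗ[ℂ] DirichletSpace p α :=
    { toFun := fun f => ⟨f.1 ∘ φ, f.2.1.comp hφ,
        (h f.1 f.2).trans_lt (ENNReal.mul_lt_top hC.lt_top f.2.2)⟩
      map_add' := fun f g => rfl
      map_smul' := fun c f => rfl }
  refine ⟨L.mkContinuous C.toReal fun f => ?_, fun f => rfl⟩
  have := ENNReal.toReal_mono (ENNReal.mul_ne_top hC f.2.2.ne) (h f.1 f.2)
  rwa [ENNReal.toReal_mul] at this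

lemma tendsto_apply_of_tendsto {u : ℕ → DirichletSpace p α} {g : DirichletSpace p α}
    (h : Tendsto u atTop (𝓝 g)) (z : 𝔻) :
    Tendsto (fun n => (u n : 𝔻 → ℂ) z) atTop (𝓝 ((g : 𝔻 → ℂ) z)) := by
  obtain ⟨C, hC, hz⟩ := exists_enorm_le_dirichletENorm (p := p) hp.out hα.out
    (norm_nonneg (z : ℂ)) z.norm_lt_one
  rw [tendsto_iff_edist_tendsto_0] at h ⊢
  have h0 : Tendsto (fun n => C * edist (u n) g) atTop (𝓝 0) := by
    simpa using ENNReal.Tendsto.const_mul h (Or.inr hC)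
  refine tendsto_of_tendsto_of_tendsto_of_le_of_le tendsto_const_nhds h0 (fun _ => zero_le)
    fun n => ?_
  have := (hz (u n - g).1 (u n - g).2 z le_rfl).2
  rw [extendZero_coe, ← enorm_dirichletSpace, ← edist_eq_enorm_sub] at this
  rwa [edist_eq_enorm_sub]

lemma memDirichlet_testFun (hβ : 0 ≤ β) (hδ : 0 < 2 + β - (2 + α) / p) (l : 𝔻) :
    MemDirichlet p α (testFun l β) := by
  obtain ⟨C, hC, h⟩ := exists_dirichletENorm_testFun_le hp.out hα.out hβ hδ
  refine ⟨isHolo_testFun l β, lt_top_iff_ne_top.2 fun htop => hC (top_le_iff.1 ?_)⟩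
  have hX : 0 < 1 - ‖(l : ℂ)‖ ^ 2 := by linarith [l.sq_norm_lt_one]
  have := h l
  rwa [htop, ENNReal.mul_top (by simpa using Real.rpow_pos_of_pos hX _)] at this

/-- The test function `F_{λ,β}` multiplied by `(1 - |λ|²)^δ`. -/
def normalizedTestFun (hβ : 0 ≤ β) (hδ : 0 < 2 + β - (2 + α) / p) (l : 𝔻) : DirichletSpace p α :=
  (((1 - ‖(l : ℂ)‖ ^ 2) ^ (2 + β - (2 + α) / p) : ℝ) : ℂ) •
    toDirichletSpace (testFun l β) (memDirichlet_testFun hβ hδ l)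

lemma enorm_rpow_one_sub_sq (l : 𝔻) (s : ℝ) :
    ‖(((1 - ‖(l : ℂ)‖ ^ 2) ^ s : ℝ) : ℂ)‖ₑ = ENNReal.ofReal ((1 - ‖(l : ℂ)‖ ^ 2) ^ s) := by
  have hX : 0 < 1 - ‖(l : ℂ)‖ ^ 2 := by linarith [l.sq_norm_lt_one]
  rw [← ofReal_norm, Complex.norm_real, Real.norm_of_nonneg (by positivity)]

lemma enorm_normalizedTestFun (hβ : 0 ≤ β) (hδ : 0 < 2 + β - (2 + α) / p) (l : 𝔻) :
    ‖normalizedTestFun hβ hδ l‖ₑ =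
      ENNReal.ofReal ((1 - ‖(l : ℂ)‖ ^ 2) ^ (2 + β - (2 + α) / p)) *
        dirichletENorm p α (testFun l β) := by
  rw [normalizedTestFun, enorm_smul, enorm_rpow_one_sub_sq, enorm_dirichletSpace,
    coe_toDirichletSpace]

lemma enorm_apply_normalizedTestFun {T : DirichletSpace p α →L[ℂ] DirichletSpace p α} {φ : 𝔻 → 𝔻}
    (hT : ∀ f, (T f : 𝔻 → ℂ) = (f : 𝔻 → ℂ) ∘ φ) (hβ : 0 ≤ β)
    (hδ : 0 < 2 + β - (2 + α) / p) (l : 𝔻) :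
    ‖T (normalizedTestFun hβ hδ l)‖ₑ = testQuantity p α β φ l := by
  rw [normalizedTestFun, map_smul, enorm_smul, enorm_rpow_one_sub_sq, enorm_dirichletSpace, hT,
    coe_toDirichletSpace]
  rfl

theorem compositionBounded_iff (hβ : 0 ≤ β) (hδ : 0 < 2 + β - (2 + α) / p) {φ : 𝔻 → 𝔻}
    (hφ : MemDirichlet p α fun z => (φ z : ℂ)) :
    CompositionBounded p α φ ↔ (⨆ l : 𝔻, testQuantity p α β φ l) < ⊤ := by
  constructor
  · rintro ⟨T, hT⟩
    obtain ⟨C, hC, h⟩ := exists_dirichletENorm_testFun_le hp.out hα.out hβ hδ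
    refine (iSup_le fun l => ?_).trans_lt
      (ENNReal.mul_lt_top (enorm_lt_top (x := T)) hC.lt_top)
    rw [← enorm_apply_normalizedTestFun hT hβ hδ]
    exact T.le_opENorm_of_le ((enorm_normalizedTestFun hβ hδ l).trans_le (h l))
  · intro h
    obtain ⟨C, hC, hle⟩ := exists_dirichletENorm_comp_le hp.out hα.out hβ hφ (ρ := 0) one_pos h.ne
      fun l _ => le_iSup (testQuantity p α β φ) l
    exact exists_compositionOperator hφ.1 hC hle

/-! ### Compactness -/

/-- At fixed `z`, `|1 - conj λ z| ≥ 1 - |z|` keeps the test function bounded, while the factor `(1 -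
|λ|²)^δ` tends to `0` since `δ > 0`. -/
lemma tendsto_normalizedTestFun_apply (hβ : 0 ≤ β) (hδ : 0 < 2 + β - (2 + α) / p) {u : ℕ → 𝔻}
    (hu : Tendsto (fun n => ‖(u n : ℂ)‖) atTop (𝓝 1)) (z : 𝔻) :
    Tendsto (fun n => (normalizedTestFun (p := p) (α := α) hβ hδ (u n) : 𝔻 → ℂ) z) atTop (𝓝 0) := by
  have hz : 0 < 1 - ‖(z : ℂ)‖ := by linarith [z.norm_lt_one]
  set s := 2 + β - (2 + α) / p with hs
  have h1 : Tendsto (fun n => (1 - ‖(u n : ℂ)‖ ^ 2) ^ s * (1 - ‖(z : ℂ)‖) ^ (-(1 + β))) atTop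
      (𝓝 0) := by
    have h2 : Tendsto (fun n => (1 - ‖(u n : ℂ)‖ ^ 2) ^ s) atTop (𝓝 ((1 - 1 ^ 2) ^ s)) :=
      (tendsto_const_nhds.sub (hu.pow 2)).rpow_const (Or.inr hδ.le)
    have := h2.mul_const ((1 - ‖(z : ℂ)‖) ^ (-(1 + β)))
    rwa [one_pow, sub_self, Real.zero_rpow hδ.ne', zero_mul] at this
  refine squeeze_zero_norm (fun n => ?_) h1
  change ‖(((1 - ‖(u n : ℂ)‖ ^ 2) ^ s : ℝ) : ℂ) * testFun (u n) β z‖ ≤ _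
  have hX : 0 < 1 - ‖(u n : ℂ)‖ ^ 2 := by linarith [(u n).sq_norm_lt_one]
  rw [norm_mul, Complex.norm_real, Real.norm_of_nonneg (by positivity), testFun, norm_div, norm_one,
    Complex.norm_cpow_real, one_div, ← Real.rpow_neg (norm_nonneg _)]
  refine mul_le_mul_of_nonneg_left (Real.rpow_le_rpow_of_nonpos hz ?_ (by linarith)) (by positivity)
  have h3 := norm_sub_norm_le (1 : ℂ) (conj (u n : ℂ) * z)
  rw [norm_mul, RCLike.norm_conj, norm_one] at h3
  nlinarith [norm_nonneg (z : ℂ), (u n).norm_lt_one]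

lemma tendsto_testQuantity_of_compact (hβ : 0 ≤ β) (hδ : 0 < 2 + β - (2 + α) / p) {φ : 𝔻 → 𝔻}
    {T : DirichletSpace p α →L[ℂ] DirichletSpace p α}
    (hT : ∀ f, (T f : 𝔻 → ℂ) = (f : 𝔻 → ℂ) ∘ φ) (hc : IsCompactOperator T) :
    Tendsto (testQuantity p α β φ) (comap (fun l : 𝔻 => ‖(l : ℂ)‖) (𝓝 1)) (𝓝 0) := by
  obtain ⟨C, hC, h⟩ := exists_dirichletENorm_testFun_le hp.out hα.out hβ hδ
  have hK := hc.isCompact_closure_image_closedBall C.toReal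
  refine tendsto_of_subseq_tendsto fun u hu => ?_
  rw [tendsto_comap_iff] at hu
  obtain ⟨g, -, ψ, hψ, hlim⟩ := hK.tendsto_subseq
    (x := fun n => T (normalizedTestFun hβ hδ (u n))) fun n => subset_closure
      ⟨_, by
        rw [mem_closedBall_zero_iff, ← ENNReal.ofReal_le_iff_le_toReal hC, ofReal_norm,
          enorm_normalizedTestFun]
        exact h _, rfl⟩
  -- Norm convergence implies pointwise convergence, so `g z` is the limit of the normalised test
  -- functions at `φ z`.
  have hg : g = 0 := by
    refine Subtype.ext (funext fun z => ?_)
    have h1 := tendsto_apply_of_tendsto hlim z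
    have h2 := (tendsto_normalizedTestFun_apply (p := p) (α := α) hβ hδ hu (φ z)).comp
      hψ.tendsto_atTop
    refine tendsto_nhds_unique h1 (h2.congr fun n => ?_)
    simp only [Function.comp_apply, hT]
  refine ⟨ψ, ?_⟩
  have h3 := (continuous_enorm.tendsto g).comp hlim
  rw [hg, enorm_zero] at h3
  exact h3.congr fun n => enorm_apply_normalizedTestFun hT hβ hδ _

lemma isCompact_closure_of_subseq {X : Type*} [PseudoMetricSpace X] {s : Set X}
    (h : ∀ u : ℕ → X, (∀ n, u n ∈ s) → ∃ (a : X) (ψ : ℕ → ℕ), StrictMono ψ ∧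
      Tendsto (u ∘ ψ) atTop (𝓝 a)) : IsCompact (closure s) := by
  refine IsSeqCompact.isCompact fun x hx => ?_
  have hy : ∀ n : ℕ, ∃ y ∈ s, dist (x n) y < 1 / ((n : ℝ) + 1) := fun n =>
    Metric.mem_closure_iff.1 (hx n) _ (by positivity)
  choose y hys hxy using hy
  obtain ⟨a, ψ, hψ, hlim⟩ := h y hys
  have hx' : Tendsto (x ∘ ψ) atTop (𝓝 a) := by
    refine (tendsto_iff_of_dist ?_).2 hlim
    refine squeeze_zero (fun _ => dist_nonneg) (fun n => (hxy (ψ n)).le) ?_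
    exact tendsto_one_div_add_atTop_nhds_zero_nat.comp hψ.tendsto_atTop
  exact ⟨a, isClosed_closure.mem_of_tendsto hx' (Eventually.of_forall fun n => hx _), ψ, hψ, hx'⟩

lemma tendsto_dirichletENorm_comp {φ : 𝔻 → 𝔻} (hβ : 0 ≤ β)
    (hφ : MemDirichlet p α fun z => (φ z : ℂ))
    (h : Tendsto (testQuantity p α β φ) (comap (fun l : 𝔻 => ‖(l : ℂ)‖) (𝓝 1)) (𝓝 0))
    {f : ℕ → 𝔻 → ℂ} (hf : ∀ n, IsHolo (f n)) {B : ℝ≥0∞} (hB : B ≠ ∞)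
    (hfB : ∀ n, dirichletENorm p α (f n) ≤ B)
    (hpt : ∀ z, Tendsto (fun n => f n z) atTop (𝓝 0))
    (hder : ∀ z ∈ Metric.ball (0 : ℂ) 1, Tendsto (fun n => derivDisc (f n) z) atTop (𝓝 0)) :
    Tendsto (fun n => dirichletENorm p α (f n ∘ φ)) atTop (𝓝 0) := by
  have hp0 : 0 < p := by linarith [hp.out]
  have := isFiniteMeasure_imageMeasure hp.out hφ
  set ν := imageMeasure p α φ with hν
  obtain ⟨C, hC, hann⟩ := exists_lintegral_annulus_le hp.out hα.out hβ hφ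
  have hBp : B ^ p ≠ ∞ := ENNReal.rpow_ne_top_of_nonneg hp0.le hB
  have hCB : C * B ^ p ≠ ∞ := ENNReal.mul_ne_top hC hBp
  have hint : Tendsto (fun n => ∫⁻ z, ‖derivDisc (f n) z‖ₑ ^ p ∂ν) atTop (𝓝 0) := by
    rw [ENNReal.tendsto_nhds_zero]
    intro ε hε
    -- `M` is fixed first to make the annulus term at most `ε / 2` for every `n`; `ρ` and `R` then
    -- depend on `M`, and only the compact disc term uses large `n`.
    obtain ⟨M, hM0, hM⟩ : ∃ M : ℝ≥0∞, 0 < M ∧ C * M ^ p * B ^ p ≤ ε / 2 := by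
      have h1 : Tendsto (fun M : ℝ≥0∞ => C * B ^ p * M ^ p) (𝓝[>] 0) (𝓝 0) := by
        have h2 : Tendsto (fun M : ℝ≥0∞ => M ^ p) (𝓝[>] 0) (𝓝 0) := by
          have := (ENNReal.continuous_rpow_const (y := p)).tendsto 0
          rw [ENNReal.zero_rpow_of_pos hp0] at this
          exact this.mono_left nhdsWithin_le_nhds
        simpa using ENNReal.Tendsto.const_mul h2 (Or.inr hCB)
      have h3 := ENNReal.tendsto_nhds_zero.1 h1 (ε / 2) (ENNReal.half_pos hε.ne')
      obtain ⟨M, hM, hM0⟩ := (h3.and self_mem_nhdsWithin).exists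
      exact ⟨M, hM0, by rwa [mul_right_comm]⟩
    obtain ⟨ρ, hρ1, hρ⟩ : ∃ ρ < 1, ∀ l : 𝔻, ρ ≤ ‖(l : ℂ)‖ → testQuantity p α β φ l ≤ M := by
      have h4 := ENNReal.tendsto_nhds_zero.1 h M hM0
      rw [eventually_comap] at h4
      obtain ⟨δ, hδ0, hδ⟩ := Metric.eventually_nhds_iff.1 h4
      refine ⟨1 - δ / 2, by linarith, fun l hl => hδ ?_ l rfl⟩
      rw [Real.dist_eq, abs_lt]
      constructor <;> linarith [l.norm_lt_one]
    set ρ' := max ρ (1 / 2) with hρ'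
    have hρ1' : ρ' < 1 := max_lt hρ1 (by norm_num)
    have hρ2 : 1 / 2 ≤ ρ' := le_max_right _ _
    set R := 1 - 2 / 3 * (1 - ρ') with hR
    have hR1 : R < 1 := by rw [hR]; linarith
    obtain ⟨D, hD, hball⟩ := exists_enorm_le_dirichletENorm (p := p) (α := α) (R := R) hp.out hα.out
      (by rw [hR]; linarith) hR1
    have hin : Tendsto (fun n => ∫⁻ z in Metric.closedBall 0 R, ‖derivDisc (f n) z‖ₑ ^ p ∂ν) atTop
        (𝓝 0) := by
      have := tendsto_lintegral_of_dominated_convergence (μ := ν.restrict (Metric.closedBall 0 R))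
        (F := fun n z => ‖derivDisc (f n) z‖ₑ ^ p) (f := fun _ => 0) (fun _ => (D * B) ^ p)
        (fun n => (measurable_derivDisc _).enorm.pow_const p)
        (fun n => by
          filter_upwards [ae_restrict_mem Metric.isClosed_closedBall.measurableSet] with z hz
          refine ENNReal.rpow_le_rpow ?_ hp0.le
          refine ((hball (f n) ⟨hf n, (hfB n).trans_lt hB.lt_top⟩ z (by simpa using hz)).1).trans ?_
          gcongr
          exact hfB n)
        (by
          rw [lintegral_const]
          exact ENNReal.mul_ne_top (ENNReal.rpow_ne_top_of_nonneg hp0.le (ENNReal.mul_ne_top hD hB))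
            (measure_ne_top _ _))
        (by
          filter_upwards [ae_restrict_mem Metric.isClosed_closedBall.measurableSet] with z hz
          have := tendsto_enorm_rpow (hder z (Metric.closedBall_subset_ball hR1 hz)) p
          rwa [enorm_zero, ENNReal.zero_rpow_of_pos hp0] at this)
      simpa using this
    filter_upwards [ENNReal.tendsto_nhds_zero.1 hin (ε / 2) (ENNReal.half_pos hε.ne')] with n hn
    refine (lintegral_imageMeasure_le_annulus_add hφ.1 R _).trans ?_
    rw [← ENNReal.add_halves ε]
    refine add_le_add ?_ hn
    refine (hann ρ' M hρ2 (fun l hl => hρ l ((le_max_left _ _).trans hl)) (f n) (hf n)).trans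
      (le_trans ?_ hM)
    gcongr
    exact hfB n
  have h0 := tendsto_enorm_rpow (hpt (φ 0)) p
  rw [enorm_zero, ENNReal.zero_rpow_of_pos hp0] at h0
  have hsum := h0.add hint
  rw [add_zero] at hsum
  have hroot := ((ENNReal.continuous_rpow_const (y := p⁻¹)).tendsto 0).comp hsum
  rw [ENNReal.zero_rpow_of_pos (by positivity)] at hroot
  refine hroot.congr fun n => ?_
  rw [Function.comp_apply, ← dirichletENorm_comp_rpow hp.out (hf n) hφ.1,
    ENNReal.rpow_rpow_inv hp0.ne']

lemma isCompactOperator_of_tendsto_testQuantity {φ : 𝔻 → 𝔻} (hβ : 0 ≤ β)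
    (hφ : MemDirichlet p α fun z => (φ z : ℂ))
    (h : Tendsto (testQuantity p α β φ) (comap (fun l : 𝔻 => ‖(l : ℂ)‖) (𝓝 1)) (𝓝 0))
    {T : DirichletSpace p α →L[ℂ] DirichletSpace p α}
    (hT : ∀ f, (T f : 𝔻 → ℂ) = (f : 𝔻 → ℂ) ∘ φ) : IsCompactOperator T := by
  refine (isCompactOperator_iff_isCompact_closure_image_closedBall
    (T : DirichletSpace p α →ₗ[ℂ] DirichletSpace p α) one_pos).2
    (isCompact_closure_of_subseq fun u hu => ?_)
  choose f hf hfu using hu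
  have hf1 : ∀ n, dirichletENorm p α (f n) ≤ 1 := fun n => by
    rw [← enorm_dirichletSpace, ← ofReal_norm, ENNReal.ofReal_le_one]
    simpa using hf n
  obtain ⟨g, ψ, hψ, hg, hg1, hpt, hder⟩ := exists_subseq_tendsto_of_dirichletENorm_le hp.out hα.out
    (fun n => (f n).2.1) ENNReal.one_ne_top hf1
  let G : DirichletSpace p α := toDirichletSpace g ⟨hg, hg1.trans_lt ENNReal.one_lt_top⟩
  refine ⟨T G, ψ, hψ, ?_⟩
  -- The differences `f (ψ n) - G` have norm at most `1 + 1`, by Fatou for the limit, and they and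
  -- their derivatives tend to `0` pointwise.
  have key := tendsto_dirichletENorm_comp (p := p) (α := α) hβ hφ h
    (f := fun n => (f (ψ n) - G).1) (fun n => (f (ψ n) - G).2.1) (B := 2) (by simp)
    (fun n => by
      rw [← enorm_dirichletSpace]
      refine enorm_sub_le.trans ?_
      rw [enorm_dirichletSpace, enorm_dirichletSpace, ← one_add_one_eq_two]
      exact add_le_add (hf1 _) hg1)
    (fun z => by
      have h1 := (hpt z).sub_const (g z)
      rwa [sub_self] at h1)
    (fun z hz => by
      have h1 := (hder z hz).sub_const (derivDisc g z)
      rw [sub_self] at h1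
      refine h1.congr fun n => ?_
      have h2 : extendZero (f (ψ n) - G).1 = extendZero (f (ψ n)).1 - extendZero g := by
        have h3 := extendZero_add (f (ψ n) - G).1 g
        have h4 : (f (ψ n) - G).1 + g = (f (ψ n)).1 := funext fun w => sub_add_cancel _ (g w)
        rw [h4] at h3
        rw [h3, add_sub_cancel_right]
      rw [derivDisc, derivDisc, derivDisc, h2,
        deriv_sub ((f (ψ n)).2.1.differentiableAt hz) (hg.differentiableAt hz)])
  rw [tendsto_iff_edist_tendsto_0]
  refine key.congr fun n => ?_
  rw [edist_eq_enorm_sub, Function.comp_apply, ← hfu, ContinuousLinearMap.coe_coe, ← map_sub,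
    enorm_dirichletSpace, hT]

theorem compositionCompact_iff (hβ : 0 ≤ β) (hδ : 0 < 2 + β - (2 + α) / p) {φ : 𝔻 → 𝔻}
    (hφ : MemDirichlet p α fun z => (φ z : ℂ)) :
    CompositionCompact p α φ ↔
      Tendsto (testQuantity p α β φ) (comap (fun l : 𝔻 => ‖(l : ℂ)‖) (𝓝 1)) (𝓝 0) := by
  refine ⟨fun ⟨T, hT, hc⟩ => tendsto_testQuantity_of_compact hβ hδ hT hc, fun h => ?_⟩
  -- The vanishing limit bounds the test quantity by `1` near the circle, which already yields the
  -- bounded operator. The `δ` obtained below is a neighbourhood radius, not the exponent.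
  have h4 := ENNReal.tendsto_nhds_zero.1 h 1 one_pos
  rw [eventually_comap] at h4
  obtain ⟨δ, hδ0, hδ1⟩ := Metric.eventually_nhds_iff.1 h4
  obtain ⟨C, hC, hle⟩ := exists_dirichletENorm_comp_le hp.out hα.out hβ hφ (ρ := 1 - δ / 2)
    (by linarith) ENNReal.one_ne_top fun l hl => hδ1 (by
      rw [Real.dist_eq, abs_lt]
      constructor <;> linarith [l.norm_lt_one]) l rfl
  obtain ⟨T, hT⟩ := exists_compositionOperator hφ.1 hC hle
  exact ⟨T, hT, isCompactOperator_of_tendsto_testQuantity hβ hφ h hT⟩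

end Operators

end WeightedDirichlet

end

theorem mainTheorem1 (p α β : ℝ) [Fact (1 ≤ p)] [Fact (-1 < α)] (hp : 1 < p) (hβ : 0 ≤ β)
    (hδ : 0 < 2 + β - (2 + α) / p) (φ : Complex.UnitDisc → Complex.UnitDisc)
    (hφ : WeightedDirichlet.MemDirichlet p α (fun z => (φ z : ℂ))) :
    (WeightedDirichlet.CompositionBounded p α φ ↔
      (⨆ l : Complex.UnitDisc, WeightedDirichlet.testQuantity p α β φ l) < ⊤) ∧
    (WeightedDirichlet.CompositionCompact p α φ ↔
      Tendsto (WeightedDirichlet.testQuantity p α β φ)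
        (comap (fun l : Complex.UnitDisc => ‖(l : ℂ)‖) (𝓝 1)) (𝓝 0)) :=
  ⟨WeightedDirichlet.compositionBounded_iff hβ hδ hφ,
    WeightedDirichlet.compositionCompact_iff hβ hδ hφ⟩
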